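/- **Setting.** Let $\mathcal X$ be a reflexive real Banach space, $\mathcal Y$ a real Hilbert space, and $\Theta:\mathcal X\to(-\infty,\infty]$ proper, lower semi-continuous and $2$-convex, i.e. for some $C_0>0$, $\Theta(\lambda z+(1-\lambda)x)+C_0\lambda(1-\lambda)\|z-x\|^2\le\lambda\Theta(z)+(1-\lambda)\Theta(x)$ for all $x,z\in\mathcal X$, $\lambda\in(0,1)$. Write $\partial\Theta(x)=\{\xi\in\mathcal X^*:D_\xi\Theta(z,x)\ge0\ \forall z\}$ with $D_\xi\Theta(z,x)=\Theta(z)-\Theta(x)-\langle\xi,z-x\rangle$, and $D(\partial\Theta)=\{x:\Theta(x)<\infty,\ \partial\Theta(x)\ne\emptyset\}$. Let $\gamma>0$ satisfy $\|z-x\|\le\gamma\,[D_\xi\Theta(z,x)]^{1/2}$ for all $z\in\mathcal X$, $x\in D(\partial\Theta)$, $\xi\in\partial\Theta(x)$. Let $\{\alpha_n\}_{n\ge0}$ satisfy $\alpha_n>0$, $1\le\alpha_n/\alpha_{n+1}\le\theta$, $\alpha_n\to0$, for a constant $\theta>1$. Let $F:D(F)\subset\mathcal X\to\mathcal Y$ and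 $y\in\mathcal Y$ satisfy, with $B_\rho(x^\dag)=\{x:\|x-x^\dag\|<\rho\}$ and constants $\rho>0$, $K_0,K_1\ge0$: (a) $D(F)$ is closed and convex, $x^\dag\in D(F)\cap D(\partial\Theta)$ and $F(x^\dag)=y$; (b) for each $x\in B_\rho(x^\dag)\cap D(F)$ there is a bounded linear operator $F'(x):\mathcal X\to\mathcal Y$ with $\lim_{t\searrow0}\frac{F(x+t(z-x))-F(x)}{t}=F'(x)(z-x)$ for all $z\in B_\rho(x^\dag)\cap D(F)$; (c) $T:=F'(x^\dag)$ satisfies $\|T\|\le\alpha_0^{1/2}/\gamma$; (d) $\|[F'(z)-F'(x)]w\|\le K_0\|z-x\|\|F'(x)w\|+K_1\|F'(x)(z-x)\|\|w\|$ for all $w\in\mathcal X$ and $x,z\in B_\rho(x^\dag)\cap D(F)$. Assume that $x^\dag$ is the only solution of $F(x)=y$ in $B_\rho(x^\dag)\cap D(F)$. **Method.** Let $\Theta_F=\Theta$ on $D(F)$ and $\Theta_F=\infty$ off $D(F)$. Given $\xi_0\in\mathcal X^*$, $\delta>0$ and $y^\delta\in\mathcal Y$ with $\|y^\delta-y\|\le\delta$,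 put $x_0^\delta=x_0:=\nabla\Theta_F^*(\xi_0)$, where $\Theta_F^*(\xi)=\sup_x\{\langle\xi,x\rangle-\Theta_F(x)\}$, and let $x_{n+1}^\delta$ be the minimizer over $x\in\mathcal X$ of $$\|y^\delta-F(x_n^\delta)-F'(x_n^\delta)(x-x_n^\delta)\|^2+\alpha_nD_{\xi_0}\Theta_F(x,x_0).$$ (Outside $B_\rho(x^\dag)\cap D(F)$, $F'(x)$ may be any bounded linear operator.) Given $\tau>1$, put $r_n=\|F(x_n^\delta)-y^\delta\|$ and let the stopping index $n_\delta$ be determined by one of the following rules. * Rule 1: $r_{n_\delta}\le\tau\delta<r_n$ for all $0\le n<n_\delta$. * Rule 2: $n_\delta=0$ if $r_0\le\tau\delta$; otherwise $n_\delta$ is the first $n\ge1$ with $\frac12(r_n+r_{n-1})\le\tau\delta$. * Rule 3: $n_\delta=0$ if $r_0\le\tau\delta$; otherwise $n_\delta$ is the first $n\ge2$ with $\max\{r_n,r_{n-1}\}\le\tau\delta$. Let $\xi^\dag\in\partial\Theta_F(x^\dag)$ realize the distance from $\xi_0$ to $\partial\Theta_F(x^\dag)$, i.e. $\|\xi_0-\xi^\dag\|=d(\xi_0,\partial\Theta_F(x^\dag))$,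 and let $\mu>0$ satisfy $\gamma\theta\mu^{-1}<\frac{\tau-1}2$. **Theorem.** There is $\varepsilon>0$, depending only on $\gamma,\theta,\tau,\mu$, such that the following holds. Suppose that $\langle\xi_0-\xi^\dag,x\rangle=0$ for all $x$ with $Tx=0$, that $(2\gamma\mu+2\gamma^2)\|\xi_0-\xi^\dag\|<\rho$, and that $(K_0+K_1)\|\xi_0-\xi^\dag\|\le\varepsilon$. Then the iterates $x_n^\delta$ exist and are unique, each of Rules 1–3 determines a unique (finite) $n_\delta$, with $x_n^\delta\in B_\rho(x^\dag)\cap D(F)$ for $0\le n\le n_\delta$, and for each of the three rules $$\|x_{n_\delta}^\delta-x^\dag\|\to0\quad\text{as }\delta\to0,$$ uniformly over all $y^\delta$ with $\|y^\delta-y\|\le\delta$. -/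

import Mathlib

open Set Filter Topology

namespace IRGN

/-- A real normed space is reflexive if the canonical embedding into its bidual is onto. -/
def IsReflexiveSpace (X : Type*) [NormedAddCommGroup X] [NormedSpace ℝ X] : Prop :=
  Function.Surjective (NormedSpace.inclusionInDoubleDual ℝ X)

section Convex

variable {X : Type*} [NormedAddCommGroup X] [NormedSpace ℝ X]

/-- The effective domain `D(Θ)` of an extended real valued function. -/
def effDomain (Θ : X → EReal) : Set X := {x | Θ x ≠ ⊤}

/-- `Θ` takes values in `(-∞, ∞]` and is not identically `∞`. -/
def IsProper (Θ : X → EReal) : Prop := (∀ x, Θ x ≠ ⊥) ∧ (effDomain Θ).Nonempty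

/-- The Bregman expression `D_ξ Θ(z, x) = Θ(z) - Θ(x) - ⟨ξ, z - x⟩`, meaningful for `x ∈ D(Θ)`. -/
noncomputable def bregman (Θ : X → EReal) (ξ : StrongDual ℝ X) (z x : X) : EReal :=
  Θ z - Θ x - ((ξ (z - x) : ℝ) : EReal)

/-- The subdifferential `∂Θ(x)`. It is empty when `Θ x = ⊤`, because then
`bregman Θ ξ z x = ⊥` for all `z`. -/
def subdiff (Θ : X → EReal) (x : X) : Set (StrongDual ℝ X) :=
  {ξ | ∀ z, 0 ≤ bregman Θ ξ z x}

/-- The domain `D(∂Θ)` of the subdifferential. -/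
def subdiffDomain (Θ : X → EReal) : Set X := {x | x ∈ effDomain Θ ∧ (subdiff Θ x).Nonempty}

/-- `2`-convexity: for some `C₀ > 0`, all `x, z` and all `0 < l < 1`,
`Θ(l z + (1 - l) x) + C₀ l (1 - l) ‖z - x‖² ≤ l Θ(z) + (1 - l) Θ(x)`. -/
def IsTwoConvex (Θ : X → EReal) : Prop :=
  ∃ C₀ : ℝ, 0 < C₀ ∧ ∀ (x z : X) (l : ℝ), 0 < l → l < 1 →
    Θ (l • z + (1 - l) • x) + ((C₀ * l * (1 - l) * ‖z - x‖ ^ 2 : ℝ) : EReal)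
      ≤ (l : EReal) * Θ z + ((1 - l : ℝ) : EReal) * Θ x

/-- `γ` is a constant with `‖z - x‖ ≤ γ (D_ξ Θ(z, x))^{1/2}` for all `z`, `x ∈ D(∂Θ)` and
`ξ ∈ ∂Θ(x)`; the inequality is written in squared form, both sides being nonnegative. -/
def IsBregmanConstant (Θ : X → EReal) (γ : ℝ) : Prop :=
  0 < γ ∧ ∀ z, ∀ x ∈ subdiffDomain Θ, ∀ ξ ∈ subdiff Θ x,
    ((‖z - x‖ ^ 2 : ℝ) : EReal) ≤ ((γ ^ 2 : ℝ) : EReal) * bregman Θ ξ z x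

/-- The Fenchel conjugate `Θ^*(ξ) = sup_x (⟨ξ, x⟩ - Θ(x))`. -/
noncomputable def fenchelConj (Θ : X → EReal) (ξ : StrongDual ℝ X) : EReal :=
  ⨆ x, (((ξ x : ℝ) : EReal) - Θ x)

/-- `x = ∇Θ^*(ξ)`: the conjugate is finite everywhere and Fréchet differentiable at `ξ`, with
derivative the evaluation at `x`. -/
def IsConjGradient (Θ : X → EReal) (ξ : StrongDual ℝ X) (x : X) : Prop :=
  (∀ η, fenchelConj Θ η ≠ ⊤ ∧ fenchelConj Θ η ≠ ⊥) ∧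
  HasFDerivAt (fun η : StrongDual ℝ X => (fenchelConj Θ η).toReal)
    (NormedSpace.inclusionInDoubleDual ℝ X x) ξ

open Classical in
/-- `Θ_F = Θ + χ_D`, where `χ_D` is `0` on `D` and `∞` off `D`. -/
noncomputable def restrictTo (Θ : X → EReal) (D : Set X) (x : X) : EReal :=
  Θ x + (if x ∈ D then 0 else ⊤)

end Convex

/-- The conditions `α_n > 0`, `1 ≤ α_n / α_{n+1} ≤ θ` and `α_n → 0`. -/
structure IsParamSeq (θ : ℝ) (α : ℕ → ℝ) : Prop where
  pos : ∀ n, 0 < α n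
  one_le_ratio : ∀ n, 1 ≤ α n / α (n + 1)
  ratio_le : ∀ n, α n / α (n + 1) ≤ θ
  tendsto_zero : Tendsto α atTop (𝓝 0)

section Operator

variable {X Y : Type*} [NormedAddCommGroup X] [NormedSpace ℝ X]
  [NormedAddCommGroup Y] [NormedSpace ℝ Y]

/-- The standing conditions on the operator `F : D ⊂ X → Y`, on its derivative `F'`, on the exact
data `y` and on the solution `xdag`. Here `F` and `F'` are total functions of which only the values
of `F` on `D` and of `F'` on `B_ρ(xdag) ∩ D` matter. -/
structure OperatorConditions (Θ : X → EReal) (D : Set X) (F : X → Y) (F' : X → X →L[ℝ] Y)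
    (y : Y) (xdag : X) (ρ γ a₀ K₀ K₁ : ℝ) : Prop where
  isClosed : IsClosed D
  convex : Convex ℝ D
  mem_domain : xdag ∈ D
  mem_subdiffDomain : xdag ∈ subdiffDomain Θ
  solution : F xdag = y
  rho_pos : 0 < ρ
  deriv : ∀ x ∈ Metric.ball xdag ρ ∩ D, ∀ z ∈ Metric.ball xdag ρ ∩ D,
    Tendsto (fun t : ℝ => t⁻¹ • (F (x + t • (z - x)) - F x)) (𝓝[>] 0) (𝓝 (F' x (z - x)))
  scaling : ‖F' xdag‖ ≤ √a₀ / γ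
  K₀_nonneg : 0 ≤ K₀
  K₁_nonneg : 0 ≤ K₁
  nonlinearity : ∀ x ∈ Metric.ball xdag ρ ∩ D, ∀ z ∈ Metric.ball xdag ρ ∩ D, ∀ w : X,
    ‖(F' z - F' x) w‖ ≤ K₀ * ‖z - x‖ * ‖F' x w‖ + K₁ * ‖F' x (z - x)‖ * ‖w‖

/-- The functional `‖yδ - F(u) - F'(u)(x - u)‖² + a D_{ξ₀} Θ_F(x, x₀)` that is minimized over `x`
in the step that starts from `u`. -/
noncomputable def stepFunctional (Θ : X → EReal) (D : Set X) (F : X → Y) (F' : X → X →L[ℝ] Y)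
    (yδ : Y) (ξ₀ : StrongDual ℝ X) (x₀ : X) (a : ℝ) (u x : X) : EReal :=
  ((‖yδ - F u - F' u (x - u)‖ ^ 2 : ℝ) : EReal)
    + (a : EReal) * bregman (restrictTo Θ D) ξ₀ x x₀

/-- `x` is the sequence of iterates: `x 0 = ∇Θ_F^*(ξ₀)`, and `x (n + 1)` minimizes the step
functional at `x n` with weight `α n` over the whole space. -/
structure IsIterates (Θ : X → EReal) (D : Set X) (F : X → Y) (F' : X → X →L[ℝ] Y)
    (α : ℕ → ℝ) (ξ₀ : StrongDual ℝ X) (yδ : Y) (x : ℕ → X) : Prop where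
  init : IsConjGradient (restrictTo Θ D) ξ₀ (x 0)
  step : ∀ n, IsMinOn (stepFunctional Θ D F F' yδ ξ₀ (x 0) (α n) (x n)) univ (x (n + 1))

/-- The annihilator in the dual of the null space of `T`. -/
def nullAnnihilator (T : X →L[ℝ] Y) : Set (StrongDual ℝ X) := {ξ | ∀ x, T x = 0 → ξ x = 0}

end Operator

/-- The three a posteriori stopping rules. -/
inductive StoppingRule where
  | discrepancy
  | average
  | maximum

/-- `rule.Selects r t n`: the rule, applied to the residuals `r m = ‖F(x_m) - yδ‖` with threshold
`t = τ δ`, stops at the index `n`. -/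
def StoppingRule.Selects (rule : StoppingRule) (r : ℕ → ℝ) (t : ℝ) (n : ℕ) : Prop :=
  match rule with
  | .discrepancy => r n ≤ t ∧ ∀ m < n, t < r m
  | .average => (r 0 ≤ t ∧ n = 0) ∨
      (t < r 0 ∧ IsLeast {m | 1 ≤ m ∧ (1 / 2 : ℝ) * (r m + r (m - 1)) ≤ t} n)
  | .maximum => (r 0 ≤ t ∧ n = 0) ∨
      (t < r 0 ∧ IsLeast {m | 2 ≤ m ∧ max (r m) (r (m - 1)) ≤ t} n)

end IRGN

/-! Write `T = F' xdag` and `E = ‖ξ₀ - ξdag‖`. The Bregman inequality is given at subgradients of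
`Θ`, whereas the method works with `Θ_F`. It is therefore upgraded to uniform convexity of `Θ` with
modulus `γ⁻² r²` (`uniformConvexOn_of_subgradient_growth`), a property that survives restriction to
`D`. This makes every step uniquely solvable and gives quadratic growth at `xdag` and at every
minimizer.

Comparing a minimizer with `xdag` bounds the error and the image error `‖T (x n - xdag)‖ / √(α n)`
by noise, a small multiple `h` of the previous image error, and the pairing of `ξ₀ - ξdag` with the
error (`step_bounds`, `step_image_bounds`). While `δ ≤ μ √(α m) E`, these bounds reproduce
themselves, so the iterates stay in the ball (`iterates_bounds`). Near the first index violating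
this inequality two consecutive residuals are at most `τ δ`, or else the initial one is; hence every
rule stops no later (`exists_stopping_bound`).

For convergence, reflexivity puts `ξ₀ - ξdag` in the closure of the range of the adjoint of `T`. An
approximate source element with defect `κ` turns the recursion into a contraction with limit `O(κ)`.
So, uniformly in the data, the error is at most `2γ δ/√(α n)` plus a small term, and the residual at
most `(1 + τ)/2 · δ` plus `o(√(α n))` (`uniform_decay`). If the stopping index is large, a residual
just before it exceeds `τ δ`; this forces `δ/√(α n)` to be small, hence the error too. Only finitely
many indices remain. For each, the iterate depends continuously on the data (`tendsto_iterates`):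
either its noise-free limit solves the equation and equals `xdag`, or its residual stays away from
zero and no rule selects that index for small `δ`. -/

namespace IRGN

/-! ### Uniformly convex functions with closed epigraph: growth, minimizers, subgradients. -/

section ConvexAnalysis

variable {X : Type*} [NormedAddCommGroup X]

/-- The function which is `φ` on `C` and `∞` off `C` has a closed epigraph. -/
def HasClosedEpigraph (C : Set X) (φ : X → ℝ) : Prop :=
  IsClosed {p : X × ℝ | p.1 ∈ C ∧ φ p.1 ≤ p.2}

theorem HasClosedEpigraph.add_continuous {C : Set X} {φ g : X → ℝ} (h : HasClosedEpigraph C φ)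
    (hg : Continuous g) : HasClosedEpigraph C (fun x => φ x + g x) := by
  have hc : Continuous fun p : X × ℝ => (p.1, p.2 - g p.1) := by fun_prop
  have := h.preimage hc
  simpa [HasClosedEpigraph, le_sub_iff_add_le] using this

theorem HasClosedEpigraph.mem_of_tendsto {C : Set X} {φ : X → ℝ} (h : HasClosedEpigraph C φ)
    {u : ℕ → X} {t : ℕ → ℝ} {x : X} {s : ℝ} (hu : Tendsto u atTop (𝓝 x))
    (ht : Tendsto t atTop (𝓝 s)) (huC : ∀ n, u n ∈ C) (hut : ∀ n, φ (u n) ≤ t n) :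
    x ∈ C ∧ φ x ≤ s :=
  (show IsClosed {p : X × ℝ | p.1 ∈ C ∧ φ p.1 ≤ p.2} from h).mem_of_tendsto (hu.prodMk_nhds ht)
    (Eventually.of_forall fun n => ⟨huC n, hut n⟩)

variable [NormedSpace ℝ X]

/-- `ξ` is a subgradient at `x` of the function which is `φ` on `C` and `∞` off `C`. -/
def IsSubgradient (C : Set X) (φ : X → ℝ) (ξ : StrongDual ℝ X) (x : X) : Prop :=
  ∀ z ∈ C, φ x + ξ (z - x) ≤ φ z

/-- Compare `x` with `l z + (1 - l) x`, divide by `l` and let `l → 0`; the limit recovers the full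
constant `c`. -/
theorem growth_of_isMinOn {C : Set X} {φ : X → ℝ} {c : ℝ}
    (hφ : UniformConvexOn C (fun r => c * r ^ 2) φ) {x : X} (hx : x ∈ C)
    (hmin : ∀ z ∈ C, φ x ≤ φ z) {z : X} (hz : z ∈ C) : φ x + c * ‖z - x‖ ^ 2 ≤ φ z := by
  have key : ∀ᶠ l : ℝ in 𝓝[>] 0, φ x + (1 - l) * (c * ‖z - x‖ ^ 2) ≤ φ z := by
    filter_upwards [Ioo_mem_nhdsGT (zero_lt_one' ℝ)] with l hl
    have h1 := hφ.2 hz hx hl.1.le (sub_nonneg.2 hl.2.le) (by ring)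
    have h2 := hmin _ (hφ.1 hz hx hl.1.le (sub_nonneg.2 hl.2.le) (by ring))
    simp only [smul_eq_mul] at h1
    have h3 : l * (φ x + (1 - l) * (c * ‖z - x‖ ^ 2)) ≤ l * φ z := by linarith
    exact le_of_mul_le_mul_left h3 hl.1
  have hlim : Tendsto (fun l : ℝ => φ x + (1 - l) * (c * ‖z - x‖ ^ 2)) (𝓝[>] 0)
      (𝓝 (φ x + (1 - 0) * (c * ‖z - x‖ ^ 2))) := by
    refine Tendsto.mono_left (Continuous.tendsto ?_ 0) nhdsWithin_le_nhds
    fun_prop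
  simpa using le_of_tendsto hlim key

theorem convexOn_clm (η : X →L[ℝ] ℝ) (C : Set X) (hC : Convex ℝ C) :
    ConvexOn ℝ C (fun x => η x) :=
  η.toLinearMap.convexOn hC

theorem UniformConvexOn.add_convexOn {C : Set X} {φ g : X → ℝ} {ψ : ℝ → ℝ}
    (hφ : UniformConvexOn C ψ φ) (hg : ConvexOn ℝ univ g) :
    UniformConvexOn C ψ (fun x => φ x + g x) := by
  have h : UniformConvexOn C 0 g :=
    (hg.subset (subset_univ _) hφ.1).uniformConvexOn_zero
  have h2 := hφ.add h
  rw [add_zero] at h2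
  exact h2

theorem IsSubgradient.growth {C : Set X} {φ : X → ℝ} {c : ℝ}
    (hφ : UniformConvexOn C (fun r => c * r ^ 2) φ) {x : X} (hx : x ∈ C) {ξ : StrongDual ℝ X}
    (h : IsSubgradient C φ ξ x) {z : X} (hz : z ∈ C) :
    φ x + ξ (z - x) + c * ‖z - x‖ ^ 2 ≤ φ z := by
  have h1 := UniformConvexOn.add_convexOn hφ (convexOn_clm (-ξ) univ convex_univ)
  have h2 := growth_of_isMinOn h1 hx (fun w hw => by
    have := h w hw
    simp only [map_sub, neg_apply] at this ⊢
    linarith) hz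
  simp only [map_sub, neg_apply] at h2 ⊢
  linarith

/-- The quadratic growth at `x` absorbs the linear term `‖ξ - η‖ ‖z - x‖` by Young's inequality.
Thus one subgradient makes every linear perturbation bounded below. -/
theorem bddBelow_of_isSubgradient {C : Set X} {φ : X → ℝ} {c : ℝ} (hc : 0 < c)
    (hφ : UniformConvexOn C (fun r => c * r ^ 2) φ) {x : X} (hx : x ∈ C) {ξ : StrongDual ℝ X}
    (h : IsSubgradient C φ ξ x) (η : StrongDual ℝ X) :
    ∃ m : ℝ, ∀ z ∈ C, m ≤ φ z - η z := by
  refine ⟨φ x - η x - ‖ξ - η‖ ^ 2 / (4 * c), fun z hz => ?_⟩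
  have h1 := h.growth hφ hx hz
  have h2 : -(‖ξ - η‖ * ‖z - x‖) ≤ (ξ - η) (z - x) :=
    neg_le_of_abs_le ((ξ - η).le_opNorm (z - x))
  simp only [map_sub, sub_apply] at h1 h2
  have h3 : ‖ξ - η‖ * ‖z - x‖ ≤ c * ‖z - x‖ ^ 2 + ‖ξ - η‖ ^ 2 / (4 * c) := by
    have : c * ‖z - x‖ ^ 2 + ‖ξ - η‖ ^ 2 / (4 * c) - ‖ξ - η‖ * ‖z - x‖
        = (2 * c * ‖z - x‖ - ‖ξ - η‖) ^ 2 / (4 * c) := by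
      field_simp; ring
    have h4 : 0 ≤ (2 * c * ‖z - x‖ - ‖ξ - η‖) ^ 2 / (4 * c) := by positivity
    linarith
  linarith

/-- Uniform convexity at midpoints makes a minimizing sequence Cauchy, so completeness and the
closed epigraph suffice, without weak compactness. -/
theorem exists_minimizer [CompleteSpace X] {C : Set X} {φ : X → ℝ} {c : ℝ} (hc : 0 < c)
    (hφ : UniformConvexOn C (fun r => c * r ^ 2) φ) (hcl : HasClosedEpigraph C φ)
    (hne : C.Nonempty) (hb : ∃ m : ℝ, ∀ z ∈ C, m ≤ φ z) : ∃ x ∈ C, ∀ z ∈ C, φ x ≤ φ z := by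
  set m := sInf (φ '' C) with hm
  have hbdd : BddBelow (φ '' C) := by
    obtain ⟨b, hb⟩ := hb
    exact ⟨b, by rintro _ ⟨z, hz, rfl⟩; exact hb z hz⟩
  have hle : ∀ z ∈ C, m ≤ φ z := fun z hz => csInf_le hbdd (mem_image_of_mem _ hz)
  have hex : ∀ n : ℕ, ∃ x ∈ C, φ x < m + 1 / ((n : ℝ) + 1) := by
    intro n
    obtain ⟨_, ⟨x, hx, rfl⟩, h⟩ := exists_lt_of_csInf_lt (hne.image φ)
      (show sInf (φ '' C) < m + 1 / ((n : ℝ) + 1) by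
        have : (0 : ℝ) < 1 / ((n : ℝ) + 1) := by positivity
        linarith)
    exact ⟨x, hx, h⟩
  choose u huC hu using hex
  have hdist : ∀ i j N : ℕ, N ≤ i → N ≤ j → dist (u i) (u j) ≤ √(4 / c * (1 / ((N : ℝ) + 1))) := by
    intro i j N hi hj
    rw [dist_eq_norm]
    apply Real.le_sqrt_of_sq_le
    have h1 := hφ.2 (huC i) (huC j) (show (0 : ℝ) ≤ 1 / 2 by norm_num)
      (show (0 : ℝ) ≤ 1 / 2 by norm_num) (by norm_num)
    have h2 := hle _ (hφ.1 (huC i) (huC j) (show (0 : ℝ) ≤ 1 / 2 by norm_num)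
      (show (0 : ℝ) ≤ 1 / 2 by norm_num) (by norm_num))
    have h3 := Nat.one_div_le_one_div (α := ℝ) hi
    have h4 := Nat.one_div_le_one_div (α := ℝ) hj
    have h5 := hu i
    have h6 := hu j
    simp only [smul_eq_mul] at h1
    have h7 : c * ‖u i - u j‖ ^ 2 ≤ 4 * (1 / ((N : ℝ) + 1)) := by linarith
    calc ‖u i - u j‖ ^ 2 = c * ‖u i - u j‖ ^ 2 / c := by field_simp
      _ ≤ 4 * (1 / ((N : ℝ) + 1)) / c := by gcongr
      _ = _ := by ring
  have hlim0 : Tendsto (fun n : ℕ => 1 / ((n : ℝ) + 1)) atTop (𝓝 0) :=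
    tendsto_one_div_add_atTop_nhds_zero_nat
  have hcau : CauchySeq u := by
    refine cauchySeq_of_le_tendsto_0 _ hdist ?_
    have := (hlim0.const_mul (4 / c)).sqrt
    simpa using this
  obtain ⟨x, hx⟩ := cauchySeq_tendsto_of_complete hcau
  have hlim1 : Tendsto (fun n : ℕ => m + 1 / ((n : ℝ) + 1)) atTop (𝓝 m) := by
    simpa using hlim0.const_add m
  obtain ⟨hxC, hxm⟩ := hcl.mem_of_tendsto hx hlim1 huC (fun n => (hu n).le)
  exact ⟨x, hxC, fun z hz => hxm.trans (hle z hz)⟩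

theorem exists_minimizer_perturbed [CompleteSpace X] {C : Set X} {φ : X → ℝ} {c : ℝ} (hc : 0 < c)
    (hφ : UniformConvexOn C (fun r => c * r ^ 2) φ) (hcl : HasClosedEpigraph C φ)
    {x₁ : X} (hx₁ : x₁ ∈ C) {ξ : StrongDual ℝ X} (h : IsSubgradient C φ ξ x₁)
    (η : StrongDual ℝ X) {g : X → ℝ} (hg : ConvexOn ℝ univ g) (hgc : Continuous g)
    (hg0 : ∀ x, 0 ≤ g x) :
    ∃ x ∈ C, ∀ z ∈ C, φ x - η x + g x + c * ‖z - x‖ ^ 2 ≤ φ z - η z + g z := by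
  have hconv : UniformConvexOn C (fun r => c * r ^ 2) (fun x => φ x + (-η) x + g x) :=
    UniformConvexOn.add_convexOn (UniformConvexOn.add_convexOn hφ
      (convexOn_clm (-η) univ convex_univ)) hg
  have hclo : HasClosedEpigraph C (fun x => φ x + (-η) x + g x) :=
    (hcl.add_continuous (-η).continuous).add_continuous hgc
  obtain ⟨m, hm⟩ := bddBelow_of_isSubgradient hc hφ hx₁ h η
  obtain ⟨x, hxC, hx⟩ := exists_minimizer hc hconv hclo ⟨x₁, hx₁⟩ ⟨m, fun z hz => by
    have := hm z hz
    have := hg0 z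
    simp only [neg_apply]
    linarith⟩
  refine ⟨x, hxC, fun z hz => ?_⟩
  have := growth_of_isMinOn hconv hxC hx hz
  simp only [neg_apply] at this
  linarith

/-- The sum rule for subdifferentials. Minimality makes the open strict epigraph of `g - g x`
disjoint from the hypograph of `φ x - φ`. A separating hyperplane cannot be vertical, since `g` is
finite everywhere; its slope is `ξ`. -/
theorem exists_isSubgradient_of_min_add {C : Set X} {φ g : X → ℝ} (hφ : ConvexOn ℝ C φ)
    (hg : ConvexOn ℝ univ g) (hgc : Continuous g) {x : X} (hx : x ∈ C)
    (hmin : ∀ z ∈ C, φ x + g x ≤ φ z + g z) :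
    ∃ ξ : StrongDual ℝ X, IsSubgradient C φ ξ x ∧ ∀ z, g x - ξ (z - x) ≤ g z := by
  have hs : Convex ℝ {p : X × ℝ | p.1 ∈ univ ∧ (fun z => g z - g x) p.1 < p.2} :=
    (hg.sub (concaveOn_const _ convex_univ)).convex_strict_epigraph
  have hso : IsOpen {p : X × ℝ | p.1 ∈ univ ∧ (fun z => g z - g x) p.1 < p.2} := by
    have : IsOpen {p : X × ℝ | g p.1 - g x < p.2} :=
      isOpen_lt (by fun_prop) (by fun_prop)
    simpa using this
  have ht : Convex ℝ {p : X × ℝ | p.1 ∈ C ∧ p.2 ≤ (fun z => φ x - φ z) p.1} :=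
    ((concaveOn_const (φ x) hφ.1).sub hφ).convex_hypograph
  obtain ⟨f, u, hfs, hft⟩ := geometric_hahn_banach_open hs hso ht (by
    rw [Set.disjoint_left]
    rintro p ⟨-, h1⟩ ⟨h2, h3⟩
    have := hmin _ h2
    simp only at h1 h3
    linarith)
  have hf : ∀ (z : X) (t : ℝ), f (z, t) = f (z, 0) + t * f (0, 1) := by
    intro z t
    rw [← smul_eq_mul, ← map_smul, ← map_add]
    simp
  have hf1 : ∀ z w : X, f (z - w, 0) = f (z, 0) - f (w, 0) := by
    intro z w
    rw [← map_sub]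
    simp
  have hu1 : u ≤ f (x, 0) := hft (x, 0) ⟨hx, by simp⟩
  have hlt : ∀ z, ∀ e : ℝ, 0 < e → f (z, 0) + (g z - g x + e) * f (0, 1) < u := by
    intro z e he
    rw [← hf]
    exact hfs (z, g z - g x + e) ⟨mem_univ _, by simpa using he⟩
  have hneg : f (0, 1) < 0 := by
    have := hlt x 1 one_pos
    simp only [sub_self, zero_add, one_mul] at this
    linarith
  have hle : ∀ z, f (z, 0) + (g z - g x) * f (0, 1) ≤ u := by
    intro z
    refine le_of_forall_pos_lt_add fun e he => ?_
    have := hlt z (e / (-f (0, 1))) (div_pos he (neg_pos.2 hneg))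
    have h2 : e / (-f (0, 1)) * f (0, 1) = -e := by
      have := hneg.ne
      field_simp
    linarith
  have hu2 : f (x, 0) ≤ u := by simpa using hle x
  refine ⟨(f (0, 1))⁻¹ • f.comp (ContinuousLinearMap.inl ℝ X ℝ), fun z hz => ?_, fun z => ?_⟩
  · have h1 := hft (z, φ x - φ z) ⟨hz, le_rfl⟩
    rw [hf] at h1
    simp only [smul_apply, ContinuousLinearMap.comp_apply,
      ContinuousLinearMap.inl_apply, smul_eq_mul, hf1]
    have h2 : (f (0, 1))⁻¹ * (f (z, 0) - f (x, 0)) ≤ φ z - φ x := by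
      rw [inv_mul_eq_div, div_le_iff_of_neg hneg]
      linarith
    linarith
  · have h1 := hle z
    simp only [smul_apply, ContinuousLinearMap.comp_apply,
      ContinuousLinearMap.inl_apply, smul_eq_mul, hf1]
    have h2 : g x - g z ≤ (f (0, 1))⁻¹ * (f (z, 0) - f (x, 0)) := by
      rw [inv_mul_eq_div, le_div_iff_of_neg hneg]
      linarith
    linarith

theorem convexOn_mul_norm_sub_sq {k : ℝ} (hk : 0 ≤ k) (p : X) :
    ConvexOn ℝ univ (fun u : X => k * ‖u - p‖ ^ 2) := by
  have h1 : ConvexOn ℝ univ (fun u : X => ‖u - p‖) := by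
    simpa [sub_eq_add_neg, Function.comp_def] using
      (convexOn_univ_norm (E := X)).translate_left (-p)
  exact (h1.pow (fun _ _ => norm_nonneg _) 2).smul hk

/-- A quadratic lower bound at all subgradients forces uniform convexity with the same constant:
points without subgradients are approximated by minimizers of `φ + k ‖· - p‖²`. -/
theorem uniformConvexOn_of_subgradient_growth [CompleteSpace X] {C : Set X} {φ : X → ℝ} {c m : ℝ}
    (hc : 0 < c) (hφ : UniformConvexOn C (fun r => c * r ^ 2) φ) (hcl : HasClosedEpigraph C φ)
    {x₁ : X} (hx₁ : x₁ ∈ C) {ξ₁ : StrongDual ℝ X} (h₁ : IsSubgradient C φ ξ₁ x₁)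
    (hB : ∀ x ∈ C, ∀ ξ : StrongDual ℝ X, IsSubgradient C φ ξ x → ∀ z ∈ C,
      φ x + ξ (z - x) + m * ‖z - x‖ ^ 2 ≤ φ z) :
    UniformConvexOn C (fun r => m * r ^ 2) φ := by
  refine ⟨hφ.1, fun z hz x hx a b ha hb hab => ?_⟩
  set p := a • z + b • x with hp
  have hpC : p ∈ C := hφ.1 hz hx ha hb hab
  have hconv : ConvexOn ℝ C φ := hφ.convexOn fun r => by simpa using by positivity
  obtain ⟨B, hBd⟩ := bddBelow_of_isSubgradient hc hφ hx₁ h₁ 0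
  simp only [zero_apply, sub_zero] at hBd
  have hex : ∀ k : ℕ, ∃ u ∈ C, ‖u - p‖ ^ 2 ≤ (φ p - B) * (1 / ((k : ℝ) + 1)) ∧
      φ u ≤ a * φ z + b * φ x - m * (a * ‖z - u‖ ^ 2 + b * ‖x - u‖ ^ 2) := by
    intro k
    have hk : (0 : ℝ) < (k : ℝ) + 1 := by positivity
    have hgconv := convexOn_mul_norm_sub_sq hk.le p
    have hgcont : Continuous (fun u : X => ((k : ℝ) + 1) * ‖u - p‖ ^ 2) := by fun_prop
    obtain ⟨u, huC, hu⟩ := exists_minimizer_perturbed hc hφ hcl hx₁ h₁ 0 hgconv hgcont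
      (fun u => by positivity)
    simp only [zero_apply, sub_zero] at hu
    obtain ⟨ξ, hξ, hξg⟩ := exists_isSubgradient_of_min_add hconv hgconv hgcont huC (fun w hw => by
      have := hu w hw
      have : 0 ≤ c * ‖w - u‖ ^ 2 := by positivity
      linarith)
    refine ⟨u, huC, ?_, ?_⟩
    · have h1 := hu p hpC
      have h2 := hBd u huC
      have h3 : 0 ≤ c * ‖p - u‖ ^ 2 := by positivity
      simp only [sub_self, norm_zero] at h1
      rw [mul_one_div, le_div_iff₀ hk]
      linarith
    · have h1 := hB u huC ξ hξ z hz
      have h2 := hB u huC ξ hξ x hx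
      -- The quadratic vanishes at `p`, so `ξ (p - u) ≥ (k + 1) ‖u - p‖² ≥ 0`. This term can be
      -- dropped from the convex combination of the two growth inequalities at `u`.
      have h3 := hξg p
      simp only [sub_self, norm_zero] at h3
      have h4 : 0 ≤ ((k : ℝ) + 1) * ‖u - p‖ ^ 2 := by positivity
      have h5 : ξ (p - u) = a * ξ (z - u) + b * ξ (x - u) := by
        have : p - u = a • (z - u) + b • (x - u) := by
          rw [hp, smul_sub, smul_sub]
          have : u = a • u + b • u := by rw [← add_smul, hab, one_smul]
          nth_rewrite 1 [this]
          abel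
        rw [this]; simp
      have h6 := mul_le_mul_of_nonneg_left h1 ha
      have h7 := mul_le_mul_of_nonneg_left h2 hb
      have h8 : φ u = a * φ u + b * φ u := by rw [← add_mul, hab, one_mul]
      nlinarith
  choose u huC hu1 hu2 using hex
  have hup : Tendsto u atTop (𝓝 p) := by
    rw [tendsto_iff_norm_sub_tendsto_zero]
    have h1 : Tendsto (fun k => ‖u k - p‖ ^ 2) atTop (𝓝 0) := by
      refine squeeze_zero (fun k => by positivity) hu1 ?_
      simpa using (tendsto_one_div_add_atTop_nhds_zero_nat (𝕜 := ℝ)).const_mul (φ p - B)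
    simpa using h1.sqrt
  have hlim : Tendsto (fun k => a * φ z + b * φ x
      - m * (a * ‖z - u k‖ ^ 2 + b * ‖x - u k‖ ^ 2)) atTop
      (𝓝 (a * φ z + b * φ x - m * (a * ‖z - p‖ ^ 2 + b * ‖x - p‖ ^ 2))) := by
    have hc : Continuous fun v : X => a * φ z + b * φ x
      - m * (a * ‖z - v‖ ^ 2 + b * ‖x - v‖ ^ 2) := by fun_prop
    exact (hc.tendsto p).comp hup
  have h1 := (hcl.mem_of_tendsto hup hlim huC hu2).2
  -- In the limit the two quadratic terms combine through `a b² + b a² = a b`.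
  have hb' : b = 1 - a := by linarith
  have hzp : ‖z - p‖ = b * ‖z - x‖ := by
    rw [show z - p = b • (z - x) by rw [hp, hb']; module, norm_smul, Real.norm_of_nonneg hb]
  have hxp : ‖x - p‖ = a * ‖z - x‖ := by
    rw [show x - p = (-a) • (z - x) by rw [hp, hb']; module, norm_smul, norm_neg,
      Real.norm_of_nonneg ha]
  rw [hzp, hxp] at h1
  simp only [smul_eq_mul]
  refine h1.trans (le_of_eq ?_)
  rw [hb']; ring

end ConvexAnalysis

/-! ### Approximate source elements. -/

section Annihilator

variable {X Y : Type*} [NormedAddCommGroup X] [NormedSpace ℝ X]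
  [NormedAddCommGroup Y] [NormedSpace ℝ Y]

/-- In a reflexive space the annihilator of the null space of `T` lies in the closure of the range
of the adjoint. -/
theorem exists_approx_source (hX : IsReflexiveSpace X) (T : X →L[ℝ] Y) {ξ : StrongDual ℝ X}
    (hξ : ξ ∈ nullAnnihilator T) {κ : ℝ} (hκ : 0 < κ) :
    ∃ ω : StrongDual ℝ Y, ‖ξ - ω.comp T‖ ≤ κ := by
  set R : Submodule ℝ (StrongDual ℝ X) :=
    LinearMap.range ((ContinuousLinearMap.compL ℝ X Y ℝ).flip T).toLinearMap with hR
  have hmem : ξ ∈ closure (R : Set (StrongDual ℝ X)) := by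
    by_contra hnot
    obtain ⟨f, s, hf1, hf2⟩ := geometric_hahn_banach_closed_point
      (R.convex.closure) isClosed_closure hnot
    -- A linear functional bounded above on a subspace vanishes there: rescaling `a` would make it
    -- attain the bound `s`, which is strict.
    have hzero : ∀ a ∈ R, f a = 0 := by
      intro a ha
      by_contra hne
      have := hf1 ((s / f a) • a) (subset_closure (R.smul_mem _ ha))
      rw [map_smul, smul_eq_mul, div_mul_cancel₀ _ hne] at this
      exact lt_irrefl _ this
    obtain ⟨x, rfl⟩ := hX f
    have hTx : T x = 0 := by
      refine SeparatingDual.eq_zero_of_forall_dual_eq_zero (R := ℝ) fun ω => ?_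
      exact hzero (ω.comp T) ⟨ω, rfl⟩
    have h0 := hf1 0 (subset_closure R.zero_mem)
    have h1 : (NormedSpace.inclusionInDoubleDual ℝ X x) ξ = 0 := hξ x hTx
    rw [map_zero] at h0
    linarith
  obtain ⟨_, ⟨ω, rfl⟩, hω⟩ := Metric.mem_closure_iff.1 hmem κ hκ
  refine ⟨ω, ?_⟩
  rw [dist_eq_norm] at hω
  exact hω.le

end Annihilator

/-! ### From extended-valued penalties to real functions on their domain; the conjugate gradient. -/

section Bridge

variable {X : Type*}

open Classical in
/-- The function which is `φ` on `C` and `∞` off `C`. -/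
noncomputable def extendTop (C : Set X) (φ : X → ℝ) (x : X) : EReal :=
  if x ∈ C then (φ x : EReal) else ⊤

theorem extendTop_of_mem {C : Set X} {φ : X → ℝ} {x : X} (hx : x ∈ C) :
    extendTop C φ x = (φ x : EReal) := if_pos hx

theorem extendTop_of_notMem {C : Set X} {φ : X → ℝ} {x : X} (hx : x ∉ C) :
    extendTop C φ x = ⊤ := if_neg hx

theorem coe_toReal_of_mem_effDomain {Θ : X → EReal} (hΘ : IsProper Θ) {x : X}
    (hx : x ∈ effDomain Θ) : ((Θ x).toReal : EReal) = Θ x :=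
  EReal.coe_toReal hx (hΘ.1 x)

theorem restrictTo_eq_extendTop {Θ : X → EReal} (hΘ : IsProper Θ) (D : Set X) :
    restrictTo Θ D = extendTop (D ∩ effDomain Θ) (fun x => (Θ x).toReal) := by
  funext x
  by_cases hD : x ∈ D
  · by_cases hx : x ∈ effDomain Θ
    · rw [extendTop_of_mem (C := D ∩ effDomain Θ) ⟨hD, hx⟩, coe_toReal_of_mem_effDomain hΘ hx]
      simp [restrictTo, hD]
    · rw [extendTop_of_notMem fun h => hx h.2]
      have : Θ x = ⊤ := not_not.1 hx
      simp [restrictTo, hD, this]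
  · rw [extendTop_of_notMem fun h => hD h.1]
    simp [restrictTo, hD, EReal.add_top_of_ne_bot (hΘ.1 x)]

theorem eq_extendTop {Θ : X → EReal} (hΘ : IsProper Θ) :
    Θ = extendTop (effDomain Θ) (fun x => (Θ x).toReal) := by
  funext x
  by_cases hx : x ∈ effDomain Θ
  · rw [extendTop_of_mem hx, coe_toReal_of_mem_effDomain hΘ hx]
  · rw [extendTop_of_notMem hx]
    exact not_not.1 hx

variable [NormedAddCommGroup X]

theorem hasClosedEpigraph_toReal {Θ : X → EReal} (hΘ : IsProper Θ) (hlsc : LowerSemicontinuous Θ)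
    {D : Set X} (hD : IsClosed D) :
    HasClosedEpigraph (D ∩ effDomain Θ) (fun x => (Θ x).toReal) := by
  have h1 : IsClosed {p : X × ℝ | Θ p.1 ≤ (p.2 : EReal)} :=
    hlsc.isClosed_epigraph.preimage
      (continuous_fst.prodMk (continuous_coe_real_ereal.comp continuous_snd))
  have h2 := (hD.preimage (continuous_fst : Continuous (Prod.fst : X × ℝ → X))).inter h1
  refine (congrArg IsClosed (Set.ext fun p => ?_)).mp h2
  constructor
  · rintro ⟨h3, h4⟩
    have h4 : Θ p.1 ≤ (p.2 : EReal) := h4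
    have h5 : p.1 ∈ effDomain Θ := (h4.trans_lt (EReal.coe_lt_top _)).ne
    refine ⟨⟨h3, h5⟩, ?_⟩
    rwa [← coe_toReal_of_mem_effDomain hΘ h5, EReal.coe_le_coe_iff] at h4
  · rintro ⟨⟨h3, h5⟩, h4⟩
    refine ⟨h3, ?_⟩
    change Θ p.1 ≤ (p.2 : EReal)
    rwa [← coe_toReal_of_mem_effDomain hΘ h5, EReal.coe_le_coe_iff]

variable [NormedSpace ℝ X]

theorem bregman_extendTop_of_mem {C : Set X} {φ : X → ℝ} {ξ : StrongDual ℝ X} {x z : X}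
    (hx : x ∈ C) (hz : z ∈ C) :
    bregman (extendTop C φ) ξ z x = ((φ z - φ x - ξ (z - x) : ℝ) : EReal) := by
  simp [bregman, extendTop_of_mem hx, extendTop_of_mem hz]

theorem bregman_extendTop_of_notMem {C : Set X} {φ : X → ℝ} {ξ : StrongDual ℝ X} {x z : X}
    (hx : x ∈ C) (hz : z ∉ C) : bregman (extendTop C φ) ξ z x = ⊤ := by
  simp [bregman, extendTop_of_mem hx, extendTop_of_notMem hz]
  rfl

theorem mem_subdiff_extendTop {C : Set X} {φ : X → ℝ} {ξ : StrongDual ℝ X} {x : X} (hx : x ∈ C) :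
    ξ ∈ subdiff (extendTop C φ) x ↔ IsSubgradient C φ ξ x := by
  constructor
  · intro h z hz
    have := h z
    rw [bregman_extendTop_of_mem hx hz, EReal.coe_nonneg] at this
    linarith
  · intro h z
    by_cases hz : z ∈ C
    · rw [bregman_extendTop_of_mem hx hz, EReal.coe_nonneg]
      have := h z hz
      linarith
    · rw [bregman_extendTop_of_notMem hx hz]
      exact le_top

theorem IsTwoConvex.uniformConvexOn {Θ : X → EReal} (hΘ : IsProper Θ) (h : IsTwoConvex Θ) :
    ∃ c : ℝ, 0 < c ∧
      UniformConvexOn (effDomain Θ) (fun r => c * r ^ 2) (fun x => (Θ x).toReal) := by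
  obtain ⟨c, hc, h⟩ := h
  have key : ∀ x ∈ effDomain Θ, ∀ z ∈ effDomain Θ, ∀ l : ℝ, 0 < l → l < 1 →
      l • z + (1 - l) • x ∈ effDomain Θ ∧ (Θ (l • z + (1 - l) • x)).toReal
        ≤ l * (Θ z).toReal + (1 - l) * (Θ x).toReal - l * (1 - l) * (c * ‖z - x‖ ^ 2) := by
    intro x hx z hz l hl0 hl1
    have h1 := h x z l hl0 hl1
    rw [← coe_toReal_of_mem_effDomain hΘ hx, ← coe_toReal_of_mem_effDomain hΘ hz,
      ← EReal.coe_mul, ← EReal.coe_mul, ← EReal.coe_add] at h1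
    have h2 : l • z + (1 - l) • x ∈ effDomain Θ := by
      intro htop
      rw [htop, EReal.top_add_coe] at h1
      exact absurd h1 (not_le.2 (EReal.coe_lt_top _))
    rw [← coe_toReal_of_mem_effDomain hΘ h2, ← EReal.coe_add, EReal.coe_le_coe_iff] at h1
    exact ⟨h2, by linarith⟩
  have key2 : ∀ z ∈ effDomain Θ, ∀ x ∈ effDomain Θ, ∀ a b : ℝ, 0 ≤ a → 0 ≤ b → a + b = 1 →
      a • z + b • x ∈ effDomain Θ ∧ (Θ (a • z + b • x)).toReal
        ≤ a • (Θ z).toReal + b • (Θ x).toReal - a * b * (c * ‖z - x‖ ^ 2) := by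
    intro z hz x hx a b ha hb hab
    obtain rfl : b = 1 - a := by linarith
    rcases ha.eq_or_lt with rfl | ha
    · simpa using hx
    rcases hb.eq_or_lt with hb0 | hb
    · have : a = 1 := by linarith
      subst this
      simpa using hz
    · simpa using key x hx z hz a ha (by linarith)
  exact ⟨c, hc, fun z hz x hx a b ha hb hab => (key2 z hz x hx a b ha hb hab).1,
    fun z hz x hx a b ha hb hab => (key2 z hz x hx a b ha hb hab).2⟩

theorem IsBregmanConstant.growth {Θ : X → EReal} (hΘ : IsProper Θ) {γ : ℝ}
    (h : IsBregmanConstant Θ γ) {x : X} (hx : x ∈ effDomain Θ) {ξ : StrongDual ℝ X}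
    (hξ : IsSubgradient (effDomain Θ) (fun x => (Θ x).toReal) ξ x) {z : X}
    (hz : z ∈ effDomain Θ) :
    (Θ x).toReal + ξ (z - x) + (γ ^ 2)⁻¹ * ‖z - x‖ ^ 2 ≤ (Θ z).toReal := by
  have hγ := h.1
  have hsub : ξ ∈ subdiff Θ x := by
    rw [eq_extendTop hΘ]
    exact (mem_subdiff_extendTop hx).2 hξ
  have h1 := h.2 z x ⟨hx, ξ, hsub⟩ ξ hsub
  rw [eq_extendTop hΘ, bregman_extendTop_of_mem hx hz, ← EReal.coe_mul,
    EReal.coe_le_coe_iff] at h1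
  have h2 : (γ ^ 2)⁻¹ * ‖z - x‖ ^ 2 ≤ (Θ z).toReal - (Θ x).toReal - ξ (z - x) := by
    rw [inv_mul_le_iff₀ (by positivity)]
    exact h1
  linarith

/-- `ξdag` is a subgradient of `Θ_F` and need not be one of `Θ`, so the Bregman inequality does not
apply to it directly. Uniform convexity is proved on the whole domain of `Θ`, where that inequality
is available, and then restricted to `D`. -/
theorem uniformConvexOn_restrict [CompleteSpace X] {Θ : X → EReal} (hΘ : IsProper Θ)
    (hlsc : LowerSemicontinuous Θ) (h2 : IsTwoConvex Θ) {γ : ℝ} (hB : IsBregmanConstant Θ γ)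
    {x₁ : X} (hx₁ : x₁ ∈ subdiffDomain Θ) {D : Set X} (hD : Convex ℝ D) :
    UniformConvexOn (D ∩ effDomain Θ) (fun r => (γ ^ 2)⁻¹ * r ^ 2) (fun x => (Θ x).toReal) := by
  obtain ⟨c, hc, huc⟩ := h2.uniformConvexOn hΘ
  obtain ⟨hx₁, ξ₁, hξ₁⟩ := hx₁
  have hcl := hasClosedEpigraph_toReal hΘ hlsc isClosed_univ
  rw [univ_inter] at hcl
  have hs : IsSubgradient (effDomain Θ) (fun x => (Θ x).toReal) ξ₁ x₁ := by
    rw [eq_extendTop hΘ] at hξ₁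
    exact (mem_subdiff_extendTop hx₁).1 hξ₁
  have := uniformConvexOn_of_subgradient_growth hc huc hcl hx₁ hs (m := (γ ^ 2)⁻¹)
    fun x hx ξ hξ z hz => hB.growth hΘ hx hξ hz
  exact ⟨hD.inter this.1, fun x hx z hz a b ha hb hab => this.2 hx.2 hz.2 ha hb hab⟩

theorem fenchelConj_extendTop {C : Set X} {φ : X → ℝ} {ξ : StrongDual ℝ X} {x : X} (hx : x ∈ C)
    (h : IsSubgradient C φ ξ x) :
    fenchelConj (extendTop C φ) ξ = ((ξ x - φ x : ℝ) : EReal) := by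
  refine le_antisymm (iSup_le fun z => ?_) ?_
  · by_cases hz : z ∈ C
    · rw [extendTop_of_mem hz, ← EReal.coe_sub, EReal.coe_le_coe_iff]
      have := h z hz
      rw [map_sub] at this
      linarith
    · rw [extendTop_of_notMem hz]
      simp
  · refine le_trans (le_of_eq ?_) (le_iSup _ x)
    rw [extendTop_of_mem hx, ← EReal.coe_sub]

theorem exists_isSubgradient_at [CompleteSpace X] {C : Set X} {φ : X → ℝ} {c : ℝ} (hc : 0 < c)
    (hφ : UniformConvexOn C (fun r => c * r ^ 2) φ) (hcl : HasClosedEpigraph C φ)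
    {x₁ : X} (hx₁ : x₁ ∈ C) {ξ₁ : StrongDual ℝ X} (h₁ : IsSubgradient C φ ξ₁ x₁)
    (η : StrongDual ℝ X) : ∃ x ∈ C, IsSubgradient C φ η x := by
  obtain ⟨x, hxC, hx⟩ := exists_minimizer_perturbed hc hφ hcl hx₁ h₁ η (g := fun _ => 0)
    (convexOn_const 0 convex_univ) continuous_const (fun _ => le_rfl)
  refine ⟨x, hxC, fun z hz => ?_⟩
  have h1 := hx z hz
  have h2 : 0 ≤ c * ‖z - x‖ ^ 2 := by positivity
  rw [map_sub]
  linarith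

/-- Two points with the same subgradient coincide, and the map from subgradients to points is
Lipschitz. -/
theorem IsSubgradient.norm_sub_le {C : Set X} {φ : X → ℝ} {c : ℝ}
    (hφ : UniformConvexOn C (fun r => c * r ^ 2) φ) {x z : X} (hx : x ∈ C) (hz : z ∈ C)
    {ξ η : StrongDual ℝ X} (hξ : IsSubgradient C φ ξ x) (hη : IsSubgradient C φ η z) :
    2 * c * ‖z - x‖ ≤ ‖η - ξ‖ := by
  have h1 := hξ.growth hφ hx hz
  have h2 := hη.growth hφ hz hx
  have h3 : (η - ξ) (z - x) ≤ ‖η - ξ‖ * ‖z - x‖ :=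
    (le_abs_self _).trans ((η - ξ).le_opNorm (z - x))
  rw [norm_sub_rev x z] at h2
  simp only [map_sub, sub_apply] at h1 h2 h3
  rcases (norm_nonneg (z - x)).eq_or_lt with h0 | h0
  · rw [← h0]; simp
  · refine le_of_mul_le_mul_right ?_ h0
    nlinarith

/-- If `z` has subgradient `η`, the first-order remainder of the conjugate at `ξ` lies between `0`
and `(η - ξ) (z - x)`. The Lipschitz bound on `z - x` makes this at most `‖η - ξ‖² / (2c)`. -/
theorem isConjGradient_of_isSubgradient [CompleteSpace X] {C : Set X} {φ : X → ℝ} {c : ℝ}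
    (hc : 0 < c) (hφ : UniformConvexOn C (fun r => c * r ^ 2) φ) (hcl : HasClosedEpigraph C φ)
    {x : X} (hx : x ∈ C) {ξ : StrongDual ℝ X} (h : IsSubgradient C φ ξ x) :
    IsConjGradient (extendTop C φ) ξ x := by
  refine ⟨fun η => ?_, ?_⟩
  · obtain ⟨z, hz, hη⟩ := exists_isSubgradient_at hc hφ hcl hx h η
    rw [fenchelConj_extendTop hz hη]
    exact ⟨EReal.coe_ne_top _, EReal.coe_ne_bot _⟩
  · rw [hasFDerivAt_iff_isLittleO]
    have hO : (fun η : StrongDual ℝ X => (fenchelConj (extendTop C φ) η).toReal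
        - (fenchelConj (extendTop C φ) ξ).toReal
        - (NormedSpace.inclusionInDoubleDual ℝ X x) (η - ξ)) =O[𝓝 ξ]
        fun η => ‖η - ξ‖ ^ 2 := by
      refine Asymptotics.IsBigO.of_bound (1 / (2 * c)) (Eventually.of_forall fun η => ?_)
      obtain ⟨z, hz, hη⟩ := exists_isSubgradient_at hc hφ hcl hx h η
      rw [fenchelConj_extendTop hz hη, fenchelConj_extendTop hx h, EReal.toReal_coe,
        EReal.toReal_coe, NormedSpace.dual_def, Real.norm_of_nonneg, norm_pow, norm_norm]
      · have h1 := h z hz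
        have h2 := IsSubgradient.norm_sub_le hφ hx hz h hη
        have h3 : (η - ξ) (z - x) ≤ ‖η - ξ‖ * ‖z - x‖ :=
          (le_abs_self _).trans ((η - ξ).le_opNorm (z - x))
        have h4 : ‖η - ξ‖ * ‖z - x‖ ≤ 1 / (2 * c) * ‖η - ξ‖ ^ 2 := by
          have : ‖z - x‖ ≤ ‖η - ξ‖ / (2 * c) := by
            rw [le_div_iff₀ (by positivity)]; linarith
          calc _ ≤ ‖η - ξ‖ * (‖η - ξ‖ / (2 * c)) := by gcongr
            _ = _ := by ring
        simp only [map_sub, sub_apply] at h1 h3 ⊢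
        linarith
      · have h1 := hη x hx
        simp only [map_sub, sub_apply] at h1 ⊢
        linarith
    refine hO.trans_isLittleO ?_
    have h1 : (fun η : StrongDual ℝ X => ‖η - ξ‖) =o[𝓝 ξ] fun _ => (1 : ℝ) := by
      rw [Asymptotics.isLittleO_one_iff]
      have : Tendsto (fun η : StrongDual ℝ X => ‖η - ξ‖) (𝓝 ξ) (𝓝 ‖ξ - ξ‖) :=
        Continuous.tendsto (by fun_prop) ξ
      simpa using this
    have h2 := h1.mul_isBigO (Asymptotics.isBigO_refl (fun η : StrongDual ℝ X => ‖η - ξ‖) (𝓝 ξ))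
    simp only [one_mul, ← sq] at h2
    exact h2.trans_isBigO (Asymptotics.isBigO_refl _ _).norm_left

/-- Some point has subgradient `ξ`, and its evaluation is the derivative of the conjugate.
Uniqueness of derivatives and injectivity of the bidual embedding identify it with `x`. -/
theorem isConjGradient_extendTop [CompleteSpace X] {C : Set X} {φ : X → ℝ} {c : ℝ}
    (hc : 0 < c) (hφ : UniformConvexOn C (fun r => c * r ^ 2) φ) (hcl : HasClosedEpigraph C φ)
    {x₁ : X} (hx₁ : x₁ ∈ C) {ξ₁ : StrongDual ℝ X} (h₁ : IsSubgradient C φ ξ₁ x₁)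
    {ξ : StrongDual ℝ X} {x : X} :
    IsConjGradient (extendTop C φ) ξ x ↔ x ∈ C ∧ IsSubgradient C φ ξ x := by
  refine ⟨fun h => ?_, fun h => isConjGradient_of_isSubgradient hc hφ hcl h.1 h.2⟩
  obtain ⟨z, hz, hξ⟩ := exists_isSubgradient_at hc hφ hcl hx₁ h₁ ξ
  have h1 := (isConjGradient_of_isSubgradient hc hφ hcl hz hξ).2.unique h.2
  obtain rfl := (NormedSpace.inclusionInDoubleDualLi ℝ (E := X)).injective h1
  exact ⟨hz, hξ⟩

end Bridge

/-! ### Existence and uniqueness of the iterates. -/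

section Iterates

variable {X Y : Type*} [NormedAddCommGroup X] [NormedSpace ℝ X]
  [NormedAddCommGroup Y] [NormedSpace ℝ Y]

/-- The iterates, expressed through the finite values `φ` of the penalty on its domain `C`. -/
structure IsRealIterates (C : Set X) (φ : X → ℝ) (F : X → Y) (F' : X → X →L[ℝ] Y)
    (α : ℕ → ℝ) (ξ₀ : StrongDual ℝ X) (yδ : Y) (x : ℕ → X) : Prop where
  mem : ∀ n, x n ∈ C
  init : IsSubgradient C φ ξ₀ (x 0)
  step : ∀ n, ∀ z ∈ C,
    ‖yδ - F (x n) - F' (x n) (x (n + 1) - x n)‖ ^ 2 + α n * (φ (x (n + 1)) - ξ₀ (x (n + 1)))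
      ≤ ‖yδ - F (x n) - F' (x n) (z - x n)‖ ^ 2 + α n * (φ z - ξ₀ z)

theorem isMinOn_stepFunctional {Θ : X → EReal} (hΘ : IsProper Θ) {D : Set X} {F : X → Y}
    {F' : X → X →L[ℝ] Y} {yδ : Y} {ξ₀ : StrongDual ℝ X} {x₀ : X} (hx₀ : x₀ ∈ D ∩ effDomain Θ)
    {a : ℝ} (ha : 0 < a) {u v : X} :
    IsMinOn (stepFunctional Θ D F F' yδ ξ₀ x₀ a u) univ v ↔
      v ∈ D ∩ effDomain Θ ∧ ∀ z ∈ D ∩ effDomain Θ,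
        ‖yδ - F u - F' u (v - u)‖ ^ 2 + a * ((Θ v).toReal - ξ₀ v)
          ≤ ‖yδ - F u - F' u (z - u)‖ ^ 2 + a * ((Θ z).toReal - ξ₀ z) := by
  have hin : ∀ z ∈ D ∩ effDomain Θ, stepFunctional Θ D F F' yδ ξ₀ x₀ a u z =
      ((‖yδ - F u - F' u (z - u)‖ ^ 2 + a * ((Θ z).toReal - (Θ x₀).toReal - ξ₀ (z - x₀)) : ℝ)
        : EReal) := by
    intro z hz
    rw [stepFunctional, restrictTo_eq_extendTop hΘ, bregman_extendTop_of_mem hx₀ hz,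
      ← EReal.coe_mul, ← EReal.coe_add]
  have hout : ∀ z, z ∉ D ∩ effDomain Θ → stepFunctional Θ D F F' yδ ξ₀ x₀ a u z = ⊤ := by
    intro z hz
    rw [stepFunctional, restrictTo_eq_extendTop hΘ, bregman_extendTop_of_notMem hx₀ hz,
      EReal.coe_mul_top_of_pos ha, EReal.coe_add_top]
  rw [isMinOn_iff]
  constructor
  · intro h
    have hv : v ∈ D ∩ effDomain Θ := by
      by_contra hv
      -- The functional is finite at `x₀` and infinite off the domain, so a minimizer lies in the
      -- domain.
      have := h x₀ (mem_univ _)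
      rw [hout v hv, hin x₀ hx₀] at this
      exact absurd this (not_le.2 (EReal.coe_lt_top _))
    refine ⟨hv, fun z hz => ?_⟩
    have := h z (mem_univ _)
    rw [hin v hv, hin z hz, EReal.coe_le_coe_iff, map_sub ξ₀, map_sub ξ₀] at this
    linarith
  · rintro ⟨hv, h⟩ z -
    by_cases hz : z ∈ D ∩ effDomain Θ
    · rw [hin v hv, hin z hz, EReal.coe_le_coe_iff, map_sub ξ₀, map_sub ξ₀]
      have := h z hz
      linarith
    · rw [hout z hz]
      exact le_top

theorem isIterates_iff [CompleteSpace X] {Θ : X → EReal} (hΘ : IsProper Θ)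
    (hlsc : LowerSemicontinuous Θ) {D : Set X} (hD : IsClosed D) {c : ℝ} (hc : 0 < c)
    (hφ : UniformConvexOn (D ∩ effDomain Θ) (fun r => c * r ^ 2) (fun x => (Θ x).toReal))
    {x₁ : X} (hx₁ : x₁ ∈ D ∩ effDomain Θ) {ξ₁ : StrongDual ℝ X}
    (h₁ : IsSubgradient (D ∩ effDomain Θ) (fun x => (Θ x).toReal) ξ₁ x₁) {F : X → Y}
    {F' : X → X →L[ℝ] Y} {α : ℕ → ℝ} (hα : ∀ n, 0 < α n) {yδ : Y} {ξ₀ : StrongDual ℝ X}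
    {x : ℕ → X} :
    IsIterates Θ D F F' α ξ₀ yδ x ↔
      IsRealIterates (D ∩ effDomain Θ) (fun x => (Θ x).toReal) F F' α ξ₀ yδ x := by
  have hinit : IsConjGradient (restrictTo Θ D) ξ₀ (x 0) ↔ x 0 ∈ D ∩ effDomain Θ ∧
      IsSubgradient (D ∩ effDomain Θ) (fun x => (Θ x).toReal) ξ₀ (x 0) := by
    rw [restrictTo_eq_extendTop hΘ]
    exact isConjGradient_extendTop hc hφ (hasClosedEpigraph_toReal hΘ hlsc hD) hx₁ h₁
  constructor
  · rintro ⟨h0, hs⟩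
    obtain ⟨h0, h0'⟩ := hinit.1 h0
    have hs' := fun n => (isMinOn_stepFunctional hΘ h0 (hα n)).1 (hs n)
    refine ⟨fun n => ?_, h0', fun n => (hs' n).2⟩
    cases n with
    | zero => exact h0
    | succ n => exact (hs' n).1
  · rintro ⟨hm, h0, hs⟩
    exact ⟨hinit.2 ⟨hm 0, h0⟩, fun n =>
      (isMinOn_stepFunctional hΘ (hm 0) (hα n)).2 ⟨hm (n + 1), hs n⟩⟩

theorem convexOn_residual_sq (b : Y) (A : X →L[ℝ] Y) (u : X) {k : ℝ} (hk : 0 ≤ k) :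
    ConvexOn ℝ univ (fun z => k * ‖b - A (z - u)‖ ^ 2) := by
  have h1 := (convexOn_univ_norm (E := Y)).comp_affineMap
    ((-A.toLinearMap).toAffineMap + AffineMap.const ℝ X (b + A u))
  have h2 : ConvexOn ℝ univ (fun z => ‖b - A (z - u)‖) := by
    have he : (fun z => ‖b - A (z - u)‖) = norm ∘ ((-A.toLinearMap).toAffineMap
        + AffineMap.const ℝ X (b + A u)) := by
      funext z
      simp only [Function.comp_apply, map_sub]
      congr 1
      simp
      abel
    rw [he]
    simpa using h1
  exact (h2.pow (fun _ _ => norm_nonneg _) 2).smul hk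

theorem exists_step [CompleteSpace X] {C : Set X} {φ : X → ℝ} {c : ℝ} (hc : 0 < c)
    (hφ : UniformConvexOn C (fun r => c * r ^ 2) φ) (hcl : HasClosedEpigraph C φ)
    {x₁ : X} (hx₁ : x₁ ∈ C) {ξ₁ : StrongDual ℝ X} (h₁ : IsSubgradient C φ ξ₁ x₁)
    (b : Y) (A : X →L[ℝ] Y) (u : X) {a : ℝ} (ha : 0 < a) (ξ₀ : StrongDual ℝ X) :
    ∃ v ∈ C, ∀ z ∈ C, ‖b - A (v - u)‖ ^ 2 + a * (φ v - ξ₀ v)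
      ≤ ‖b - A (z - u)‖ ^ 2 + a * (φ z - ξ₀ z) := by
  obtain ⟨v, hv, h⟩ := exists_minimizer_perturbed hc hφ hcl hx₁ h₁ ξ₀
    (convexOn_residual_sq b A u (inv_nonneg.2 ha.le)) (by fun_prop) (fun z => by positivity)
  refine ⟨v, hv, fun z hz => ?_⟩
  have h1 := h z hz
  have h2 : 0 ≤ c * ‖z - v‖ ^ 2 := by positivity
  have h3 : a * (φ v - ξ₀ v + a⁻¹ * ‖b - A (v - u)‖ ^ 2)
      ≤ a * (φ z - ξ₀ z + a⁻¹ * ‖b - A (z - u)‖ ^ 2) := 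
    mul_le_mul_of_nonneg_left (by linarith) ha.le
  have h4 : ∀ t : ℝ, a * (a⁻¹ * t) = t := fun t => mul_inv_cancel_left₀ ha.ne' t
  rw [mul_add, mul_add, h4, h4] at h3
  linarith

/-- Minimality in a step of the method, with the quadratic growth. -/
theorem step_growth {C : Set X} {φ : X → ℝ} {c : ℝ}
    (hφ : UniformConvexOn C (fun r => c * r ^ 2) φ) {b : Y} {A : X →L[ℝ] Y} {u v : X} {a : ℝ}
    (ha : 0 < a) {ξ₀ : StrongDual ℝ X} (hv : v ∈ C)
    (h : ∀ z ∈ C, ‖b - A (v - u)‖ ^ 2 + a * (φ v - ξ₀ v)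
      ≤ ‖b - A (z - u)‖ ^ 2 + a * (φ z - ξ₀ z)) {z : X} (hz : z ∈ C) :
    ‖b - A (v - u)‖ ^ 2 + a * (φ v - ξ₀ v) + a * (c * ‖z - v‖ ^ 2)
      ≤ ‖b - A (z - u)‖ ^ 2 + a * (φ z - ξ₀ z) := by
  have hconv := UniformConvexOn.add_convexOn (UniformConvexOn.add_convexOn hφ
    (convexOn_clm (-ξ₀) univ convex_univ)) (convexOn_residual_sq b A u (inv_nonneg.2 ha.le))
  have h4 : ∀ t : ℝ, a * (a⁻¹ * t) = t := fun t => mul_inv_cancel_left₀ ha.ne' t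
  have h1 := growth_of_isMinOn hconv hv (fun w hw => by
    have := h w hw
    refine le_of_mul_le_mul_left ?_ ha
    simp only [neg_apply, mul_add, h4]
    linarith) hz
  have h2 := mul_le_mul_of_nonneg_left h1 ha.le
  simp only [neg_apply, mul_add, h4] at h2
  linarith

theorem existsUnique_isRealIterates [CompleteSpace X] {C : Set X} {φ : X → ℝ} {c : ℝ} (hc : 0 < c)
    (hφ : UniformConvexOn C (fun r => c * r ^ 2) φ) (hcl : HasClosedEpigraph C φ)
    {x₁ : X} (hx₁ : x₁ ∈ C) {ξ₁ : StrongDual ℝ X} (h₁ : IsSubgradient C φ ξ₁ x₁)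
    (F : X → Y) (F' : X → X →L[ℝ] Y) {α : ℕ → ℝ} (hα : ∀ n, 0 < α n) (ξ₀ : StrongDual ℝ X)
    (yδ : Y) : ∃! x : ℕ → X, IsRealIterates C φ F F' α ξ₀ yδ x := by
  obtain ⟨x₀, hx₀, hξ₀⟩ := exists_isSubgradient_at hc hφ hcl hx₁ h₁ ξ₀
  choose f hfC hf using fun (n : ℕ) (u : X) =>
    exists_step hc hφ hcl hx₁ h₁ (yδ - F u) (F' u) u (hα n) ξ₀
  refine ⟨fun n => Nat.rec x₀ f n, ⟨fun n => ?_, hξ₀, fun n => hf n _⟩, fun x hx => ?_⟩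
  · cases n with
    | zero => exact hx₀
    | succ n => exact hfC n _
  · funext n
    induction n with
    | zero =>
      have h := IsSubgradient.norm_sub_le hφ hx₀ (hx.mem 0) hξ₀ hx.init
      rw [sub_self, norm_zero] at h
      have h0 : ‖x 0 - x₀‖ ≤ 0 := by
        by_contra hpos
        have := mul_pos (mul_pos two_pos hc) (not_le.1 hpos)
        linarith
      exact sub_eq_zero.1 (norm_le_zero_iff.1 h0)
    | succ n ih =>
      -- Quadratic growth at one minimizer, tested at the other, forces the two to coincide.
      have h1 := step_growth hφ (hα n) (hx.mem (n + 1)) (hx.step n) (hfC n (x n))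
      have h2 := hf n (x n) _ (hx.mem (n + 1))
      have h0 : ‖f n (x n) - x (n + 1)‖ ≤ 0 := by
        by_contra hpos
        have := mul_pos (hα n) (mul_pos hc (pow_pos (not_le.1 hpos) 2))
        linarith
      have h3 := sub_eq_zero.1 (norm_le_zero_iff.1 h0)
      rw [← h3]
      change f n (x n) = f n _
      rw [ih]

end Iterates

/-! ### Taylor estimate from one-sided directional derivatives. -/

section Taylor

variable {X Y : Type*} [NormedAddCommGroup X] [NormedSpace ℝ X]
  [NormedAddCommGroup Y] [NormedSpace ℝ Y]

theorem add_smul_sub_mem {B : Set X} (hB : Convex ℝ B) {x z : X} (hx : x ∈ B) (hz : z ∈ B) {t : ℝ}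
    (h0 : 0 ≤ t) (h1 : t ≤ 1) : x + t • (z - x) ∈ B :=
  hB.add_smul_sub_mem hx hz ⟨h0, h1⟩

theorem hasDerivWithinAt_segment {B : Set X} (hB : Convex ℝ B) {F : X → Y} {F' : X → X →L[ℝ] Y}
    (hF : ∀ x ∈ B, ∀ z ∈ B,
      Tendsto (fun t : ℝ => t⁻¹ • (F (x + t • (z - x)) - F x)) (𝓝[>] 0) (𝓝 (F' x (z - x))))
    {x z : X} (hx : x ∈ B) (hz : z ∈ B) {t : ℝ} (ht : t ∈ Ico (0 : ℝ) 1) :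
    HasDerivWithinAt (fun s : ℝ => F (x + s • (z - x))) (F' (x + t • (z - x)) (z - x))
      (Ici t) t := by
  rw [← hasDerivWithinAt_Ioi_iff_Ici, hasDerivWithinAt_iff_tendsto_slope' (by simp)]
  have h1t : 0 < 1 - t := sub_pos.2 ht.2
  -- Differentiability is assumed only in directions towards points of `B`. From the intermediate
  -- point, `z` lies in direction `(1 - t) (z - x)`, so the parameter is rescaled by `1 - t`.
  have h := hF _ (add_smul_sub_mem hB hx hz ht.1 ht.2.le) z hz
  have hsub : Tendsto (fun s : ℝ => (s - t) / (1 - t)) (𝓝[>] t) (𝓝[>] 0) := by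
    refine tendsto_nhdsWithin_iff.2 ⟨?_, ?_⟩
    · have : Tendsto (fun s : ℝ => (s - t) / (1 - t)) (𝓝 t) (𝓝 ((t - t) / (1 - t))) :=
        Continuous.tendsto (by fun_prop) t
      rw [sub_self, zero_div] at this
      exact this.mono_left nhdsWithin_le_nhds
    · filter_upwards [self_mem_nhdsWithin] with s hs
      exact div_pos (sub_pos.2 hs) h1t
  have h2 := (h.comp hsub).const_smul (1 - t)⁻¹
  have e1 : z - (x + t • (z - x)) = (1 - t) • (z - x) := by module
  rw [e1, map_smul, smul_smul, inv_mul_cancel₀ h1t.ne', one_smul] at h2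
  refine h2.congr fun s => ?_
  rw [slope_def_module, Function.comp_apply, smul_smul, smul_smul, div_mul_cancel₀ _ h1t.ne']
  congr 1
  · rw [inv_div]; field_simp
  · congr 2; module

/-- One-sided derivatives give right continuity; left continuity comes from traversing the segment
in the opposite direction. -/
theorem continuousOn_segment {B : Set X} (hB : Convex ℝ B) {F : X → Y} {F' : X → X →L[ℝ] Y}
    (hF : ∀ x ∈ B, ∀ z ∈ B,
      Tendsto (fun t : ℝ => t⁻¹ • (F (x + t • (z - x)) - F x)) (𝓝[>] 0) (𝓝 (F' x (z - x))))
    {x z : X} (hx : x ∈ B) (hz : z ∈ B) :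
    ContinuousOn (fun s : ℝ => F (x + s • (z - x))) (Icc 0 1) := by
  intro t ht
  have hR : ContinuousWithinAt (fun s : ℝ => F (x + s • (z - x))) (Icc t 1) t := by
    rcases ht.2.eq_or_lt with rfl | h1
    · simp
    · exact ((hasDerivWithinAt_segment hB hF hx hz ⟨ht.1, h1⟩).continuousWithinAt).mono
        Icc_subset_Ici_self
  have hL : ContinuousWithinAt (fun s : ℝ => F (x + s • (z - x))) (Icc 0 t) t := by
    rcases ht.1.eq_or_lt with rfl | h0
    · simp
    · have h := (hasDerivWithinAt_segment hB hF hz hx (t := 1 - t)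
        ⟨sub_nonneg.2 ht.2, by linarith⟩).continuousWithinAt
      have hc : ContinuousWithinAt (fun s : ℝ => 1 - s) (Icc 0 t) t := by fun_prop
      have h2 := ContinuousWithinAt.comp h hc (fun s hs => sub_le_sub_left hs.2 1)
      refine h2.congr (fun s _ => ?_) ?_ <;>
      · simp only [Function.comp_apply]
        congr 1; module
  exact (hL.union hR).mono fun s hs => by
    rcases le_total s t with h | h
    · exact Or.inl ⟨hs.1, h⟩
    · exact Or.inr ⟨h, hs.2⟩

/-- Mean value inequality for right derivatives along the segment. The nonlinearity condition bounds
the derivative defect at parameter `t` by `t` times the right-hand side, and `t ≤ 1` is enough here.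
-/
theorem norm_taylor_le {B : Set X} (hB : Convex ℝ B) {F : X → Y} {F' : X → X →L[ℝ] Y}
    (hF : ∀ x ∈ B, ∀ z ∈ B,
      Tendsto (fun t : ℝ => t⁻¹ • (F (x + t • (z - x)) - F x)) (𝓝[>] 0) (𝓝 (F' x (z - x))))
    {K₀ K₁ : ℝ} (hK₀ : 0 ≤ K₀) (hK₁ : 0 ≤ K₁)
    (hnl : ∀ x ∈ B, ∀ z ∈ B, ∀ w : X,
      ‖(F' z - F' x) w‖ ≤ K₀ * ‖z - x‖ * ‖F' x w‖ + K₁ * ‖F' x (z - x)‖ * ‖w‖)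
    {x z : X} (hx : x ∈ B) (hz : z ∈ B) :
    ‖F z - F x - F' x (z - x)‖ ≤ (K₀ + K₁) * ‖z - x‖ * ‖F' x (z - x)‖ := by
  have h := norm_image_sub_le_of_norm_deriv_right_le_segment
    (f := fun s : ℝ => F (x + s • (z - x)) - s • F' x (z - x))
    (f' := fun s => F' (x + s • (z - x)) (z - x) - F' x (z - x)) (a := 0) (b := 1)
    (C := (K₀ + K₁) * ‖z - x‖ * ‖F' x (z - x)‖)
    ((continuousOn_segment hB hF hx hz).sub (by fun_prop))
    (fun t ht => by
      have h1 := hasDerivWithinAt_segment hB hF hx hz ht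
      have h2 : HasDerivWithinAt (fun s : ℝ => s • F' x (z - x)) (F' x (z - x)) (Ici t) t := by
        simpa using (hasDerivWithinAt_id t (Ici t)).smul_const (F' x (z - x))
      exact h1.sub h2)
    (fun t ht => by
      have h1 := hnl x hx _ (add_smul_sub_mem hB hx hz ht.1 ht.2.le) (z - x)
      rw [add_sub_cancel_left, map_smul, norm_smul, norm_smul, Real.norm_of_nonneg ht.1,
        sub_apply] at h1
      have h3 : t * ((K₀ + K₁) * ‖z - x‖ * ‖F' x (z - x)‖)
          ≤ 1 * ((K₀ + K₁) * ‖z - x‖ * ‖F' x (z - x)‖) := by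
        have := ht.2.le
        gcongr
      nlinarith) 1 ⟨zero_le_one, le_rfl⟩
  simpa [sub_right_comm] using h

end Taylor

/-! ### Error propagation in one step and along the iteration. -/

section Step

/-- The scalar inequality behind the error estimate of one step. -/
theorem quadratic_step_bounds {r d A s γ κ S : ℝ} (hA : 0 ≤ A) (hs : 0 < s)
    (hγ : 0 < γ) (hκ : 0 ≤ κ) (hS : 0 ≤ S)
    (h : r ^ 2 + s ^ 2 * ((γ ^ 2)⁻¹ * d ^ 2) ≤ A ^ 2 + s ^ 2 * (κ * d + S ^ 2)) :
    r ≤ A + s * (γ * κ / 2 + S) ∧ s * d ≤ γ * A + s * (γ ^ 2 * κ + γ * S) := by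
  -- In terms of `q = d / γ`, the first bound completes the square in `q - γκ/2`. The second
  -- compares `s q (s q - s γ κ)` with `(A + s S)²`.
  obtain ⟨q, rfl⟩ : ∃ q, d = γ * q := ⟨d / γ, by field_simp⟩
  have h1 : (γ ^ 2)⁻¹ * (γ * q) ^ 2 = q ^ 2 := by field_simp
  rw [h1] at h
  constructor
  · refine le_of_sq_le_sq ?_ (by positivity)
    have h2 : 0 ≤ s ^ 2 * (q - γ * κ / 2) ^ 2 := by positivity
    have h3 : 0 ≤ A * s * (γ * κ / 2 + S) := by positivity
    have h4 : 0 ≤ s ^ 2 * (γ * κ * S) := by positivity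
    nlinarith
  · have h2 : s * q ≤ A + s * (γ * κ + S) := by
      by_contra hcon
      push Not at hcon
      have h3 : A + s * S < s * q - s * (γ * κ) := by linarith
      have h4 : 0 ≤ A + s * S := by positivity
      have h5 : 0 ≤ s * (γ * κ) := by positivity
      have h6 : (A + s * S) ^ 2 < (s * q) * (s * q - s * (γ * κ)) := by
        nlinarith
      have h7 : 0 ≤ A * (s * S) := by positivity
      nlinarith
    calc s * (γ * q) = γ * (s * q) := by ring
      _ ≤ γ * (A + s * (γ * κ + S)) := by gcongr
      _ = _ := by ring

variable {X Y : Type*} [NormedAddCommGroup X] [NormedSpace ℝ X]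
  [NormedAddCommGroup Y] [NormedSpace ℝ Y]

/-- The standing assumptions of the convergence analysis, for the finite values `φ` of the penalty
on its domain `C`; the number `h` bounds the nonlinearity of `F` along the iteration. -/
structure GNSetting (C D : Set X) (φ : X → ℝ) (F : X → Y) (F' : X → X →L[ℝ] Y) (xdag : X)
    (ρ γ θ μ K₀ K₁ h : ℝ) (α : ℕ → ℝ) (ξ₀ ξdag : StrongDual ℝ X) : Prop where
  γ_pos : 0 < γ
  one_lt_θ : 1 < θ
  μ_pos : 0 < μ
  h_nonneg : 0 ≤ h
  h_le : h ≤ 1 / 4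
  θ_mul_h_le : 20 * θ * h ≤ 1
  h_mul_le : 2 * h * (2 * θ * (4 * μ + γ)) ≤ μ + γ
  subset : C ⊆ D
  convex : Convex ℝ D
  mem : xdag ∈ C
  deriv : ∀ x ∈ Metric.ball xdag ρ ∩ D, ∀ z ∈ Metric.ball xdag ρ ∩ D,
    Tendsto (fun t : ℝ => t⁻¹ • (F (x + t • (z - x)) - F x)) (𝓝[>] 0) (𝓝 (F' x (z - x)))
  scaling : ‖F' xdag‖ ≤ √(α 0) / γ
  K₀_nonneg : 0 ≤ K₀
  K₁_nonneg : 0 ≤ K₁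
  nonlinearity : ∀ x ∈ Metric.ball xdag ρ ∩ D, ∀ z ∈ Metric.ball xdag ρ ∩ D, ∀ w : X,
    ‖(F' z - F' x) w‖ ≤ K₀ * ‖z - x‖ * ‖F' x w‖ + K₁ * ‖F' x (z - x)‖ * ‖w‖
  α_pos : ∀ n, 0 < α n
  α_anti : ∀ n, α (n + 1) ≤ α n
  sqrt_α_le : ∀ n, √(α n) ≤ θ * √(α (n + 1))
  sqrt_α_le_two : ∀ n, √(α n) ≤ θ * √(α (n + 2))
  α_tendsto : Tendsto α atTop (𝓝 0)
  uniformConvexOn : UniformConvexOn C (fun r => (γ ^ 2)⁻¹ * r ^ 2) φ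
  isSubgradient : IsSubgradient C φ ξdag xdag
  radius_lt : (2 * γ * μ + 2 * γ ^ 2) * ‖ξ₀ - ξdag‖ < ρ
  small : (K₀ + K₁) * ((2 * γ * μ + 2 * γ ^ 2) * ‖ξ₀ - ξdag‖) ≤ h

namespace GNSetting

variable {C D : Set X} {φ : X → ℝ} {F : X → Y} {F' : X → X →L[ℝ] Y} {xdag : X}
  {ρ γ θ μ K₀ K₁ h : ℝ} {α : ℕ → ℝ} {ξ₀ ξdag : StrongDual ℝ X}

theorem rho_pos (G : GNSetting C D φ F F' xdag ρ γ θ μ K₀ K₁ h α ξ₀ ξdag) : 0 < ρ := by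
  have := G.γ_pos
  have := G.μ_pos
  exact lt_of_le_of_lt (by positivity) G.radius_lt

theorem xdag_mem (G : GNSetting C D φ F F' xdag ρ γ θ μ K₀ K₁ h α ξ₀ ξdag) :
    xdag ∈ Metric.ball xdag ρ ∩ D := ⟨Metric.mem_ball_self G.rho_pos, G.subset G.mem⟩

theorem taylor (G : GNSetting C D φ F F' xdag ρ γ θ μ K₀ K₁ h α ξ₀ ξdag) {x z : X}
    (hx : x ∈ Metric.ball xdag ρ ∩ D) (hz : z ∈ Metric.ball xdag ρ ∩ D) :
    ‖F z - F x - F' x (z - x)‖ ≤ (K₀ + K₁) * ‖z - x‖ * ‖F' x (z - x)‖ :=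
  norm_taylor_le ((convex_ball _ _).inter G.convex) G.deriv G.K₀_nonneg G.K₁_nonneg G.nonlinearity
    hx hz

theorem norm_deriv_apply_sub_le (G : GNSetting C D φ F F' xdag ρ γ θ μ K₀ K₁ h α ξ₀ ξdag) {u : X}
    (hu : u ∈ Metric.ball xdag ρ ∩ D) (huh : (K₀ + K₁) * ‖u - xdag‖ ≤ h) :
    ‖F' u (u - xdag)‖ ≤ (1 + h) * ‖F' xdag (u - xdag)‖ := by
  have h1 := G.nonlinearity xdag G.xdag_mem u hu (u - xdag)
  have h2 : ‖F' u (u - xdag)‖ ≤ ‖F' xdag (u - xdag)‖ + ‖(F' u - F' xdag) (u - xdag)‖ := by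
    rw [sub_apply]
    exact norm_le_norm_add_norm_sub' _ _
  have h3 : (K₀ + K₁) * ‖u - xdag‖ * ‖F' xdag (u - xdag)‖ ≤ h * ‖F' xdag (u - xdag)‖ := by
    gcongr
  linarith

theorem norm_linearization_le (G : GNSetting C D φ F F' xdag ρ γ θ μ K₀ K₁ h α ξ₀ ξdag) {u : X}
    (hu : u ∈ Metric.ball xdag ρ ∩ D) (huh : (K₀ + K₁) * ‖u - xdag‖ ≤ h) {yδ : Y} {δ : ℝ}
    (hy : ‖yδ - F xdag‖ ≤ δ) :
    ‖yδ - F u - F' u (xdag - u)‖ ≤ δ + 2 * h * ‖F' xdag (u - xdag)‖ := by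
  have h1 := G.taylor hu G.xdag_mem
  have h2 := G.norm_deriv_apply_sub_le hu huh
  rw [← neg_sub u xdag, map_neg, norm_neg, norm_neg] at h1
  rw [← neg_sub u xdag, map_neg]
  have h3 : yδ - F u - -F' u (u - xdag) = (yδ - F xdag) + (F xdag - F u - -F' u (u - xdag)) := by
    abel
  rw [h3]
  refine (norm_add_le _ _).trans ?_
  have h0 := G.h_nonneg
  have h4 : (K₀ + K₁) * ‖u - xdag‖ * ‖F' u (u - xdag)‖
      ≤ h * ((1 + h) * ‖F' xdag (u - xdag)‖) := by gcongr
  have h5 : h * ((1 + h) * ‖F' xdag (u - xdag)‖) ≤ h * (2 * ‖F' xdag (u - xdag)‖) := by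
    have := G.h_le
    gcongr
    linarith
  linarith

theorem norm_value_sub_le (G : GNSetting C D φ F F' xdag ρ γ θ μ K₀ K₁ h α ξ₀ ξdag) {u : X}
    (hu : u ∈ Metric.ball xdag ρ ∩ D) (huh : (K₀ + K₁) * ‖u - xdag‖ ≤ h) :
    ‖F u - F xdag‖ ≤ (1 + h) * ‖F' xdag (u - xdag)‖ := by
  have h1 := G.taylor G.xdag_mem hu
  have h2 : ‖F u - F xdag‖ ≤ ‖F' xdag (u - xdag)‖ + ‖F u - F xdag - F' xdag (u - xdag)‖ :=
    norm_le_norm_add_norm_sub' _ _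
  have h3 : (K₀ + K₁) * ‖u - xdag‖ * ‖F' xdag (u - xdag)‖ ≤ h * ‖F' xdag (u - xdag)‖ := by
    gcongr
  linarith

/-- Bounds for one step from `u` to `v`, with weight `a`. The hypothesis on `ξ₀ - ξdag` is an
approximate source condition with defect `κ` and the remainder `S ^ 2`. -/
theorem step_bounds (G : GNSetting C D φ F F' xdag ρ γ θ μ K₀ K₁ h α ξ₀ ξdag) {u v : X} {a : ℝ}
    (ha : 0 < a) (hu : u ∈ Metric.ball xdag ρ ∩ D) (huh : (K₀ + K₁) * ‖u - xdag‖ ≤ h)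
    (hv : v ∈ C) {yδ : Y} {δ : ℝ} (hy : ‖yδ - F xdag‖ ≤ δ)
    (hmin : ∀ z ∈ C, ‖yδ - F u - F' u (v - u)‖ ^ 2 + a * (φ v - ξ₀ v)
      ≤ ‖yδ - F u - F' u (z - u)‖ ^ 2 + a * (φ z - ξ₀ z))
    {κ S p q : ℝ} (hκ : 0 ≤ κ) (hS : 0 ≤ S)
    (hsource : (ξ₀ - ξdag) (v - xdag) ≤ κ * ‖v - xdag‖ + S ^ 2)
    (hp : ‖F' xdag (u - xdag)‖ ≤ √a * p) (hq : δ ≤ √a * q) :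
    ‖yδ - F u - F' u (xdag - u)‖ ≤ √a * (q + 2 * h * p) ∧
    ‖yδ - F u - F' u (v - u)‖ ≤ √a * (q + 2 * h * p + γ * κ / 2 + S) ∧
    ‖v - xdag‖ ≤ γ * (q + 2 * h * p) + γ ^ 2 * κ + γ * S := by
  have hs : 0 < √a := Real.sqrt_pos.2 ha
  have hγ := G.γ_pos
  have h0 := G.h_nonneg
  have hA : ‖yδ - F u - F' u (xdag - u)‖ ≤ √a * (q + 2 * h * p) := by
    have h1 := G.norm_linearization_le hu huh hy
    have h2 : 2 * h * ‖F' xdag (u - xdag)‖ ≤ 2 * h * (√a * p) := by gcongr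
    linarith
  have hsub := G.isSubgradient.growth G.uniformConvexOn G.mem hv
  have hm := hmin xdag G.mem
  have hquad : ‖yδ - F u - F' u (v - u)‖ ^ 2 + √a ^ 2 * ((γ ^ 2)⁻¹ * ‖v - xdag‖ ^ 2)
      ≤ ‖yδ - F u - F' u (xdag - u)‖ ^ 2 + √a ^ 2 * (κ * ‖v - xdag‖ + S ^ 2) := by
    rw [Real.sq_sqrt ha.le]
    simp only [map_sub, sub_apply] at hsub hsource
    have h1 : a * ((γ ^ 2)⁻¹ * ‖v - xdag‖ ^ 2)
        ≤ a * (φ v - φ xdag - (ξdag v - ξdag xdag)) := by gcongr; linarith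
    have h2 : a * (ξ₀ v - ξdag v - (ξ₀ xdag - ξdag xdag)) ≤ a * (κ * ‖v - xdag‖ + S ^ 2) := by
      gcongr
    linarith
  obtain ⟨h1, h2⟩ := quadratic_step_bounds (norm_nonneg _) hs hγ hκ hS hquad
  refine ⟨hA, by linarith, ?_⟩
  refine le_of_mul_le_mul_left ?_ hs
  have h3 := mul_le_mul_of_nonneg_left hA hγ.le
  linarith

/-- `F' u (v - xdag)` is the difference of the linearized residuals at `xdag` and at `v`, both
controlled by `step_bounds`. The nonlinearity condition transfers this to `F' xdag`, and the Taylor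
estimate transfers the linearized residual at `v` to the true one. -/
theorem step_image_bounds (G : GNSetting C D φ F F' xdag ρ γ θ μ K₀ K₁ h α ξ₀ ξdag) {u v : X}
    {a : ℝ} (ha : 0 < a) (hu : u ∈ Metric.ball xdag ρ ∩ D) (huh : (K₀ + K₁) * ‖u - xdag‖ ≤ h)
    (hv : v ∈ C) {yδ : Y} {δ : ℝ} (hy : ‖yδ - F xdag‖ ≤ δ)
    (hmin : ∀ z ∈ C, ‖yδ - F u - F' u (v - u)‖ ^ 2 + a * (φ v - ξ₀ v)
      ≤ ‖yδ - F u - F' u (z - u)‖ ^ 2 + a * (φ z - ξ₀ z))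
    {κ S p q : ℝ} (hκ : 0 ≤ κ) (hS : 0 ≤ S)
    (hsource : (ξ₀ - ξdag) (v - xdag) ≤ κ * ‖v - xdag‖ + S ^ 2)
    (hp : ‖F' xdag (u - xdag)‖ ≤ √a * p) (hq : δ ≤ √a * q)
    (hvb : v ∈ Metric.ball xdag ρ) (hvh : (K₀ + K₁) * ‖v - xdag‖ ≤ h) :
    ‖F' xdag (v - xdag)‖ ≤ 2 * √a * (2 * q + 5 * h * p + γ * κ / 2 + S) ∧
    ‖F v - yδ‖ ≤ √a * ((1 + 4 * h) * q + 8 * h * p + γ * κ + 2 * S) := by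
  obtain ⟨hA, hR, -⟩ := G.step_bounds ha hu huh hv hy hmin hκ hS hsource hp hq
  have hs : 0 < √a := Real.sqrt_pos.2 ha
  have hγ := G.γ_pos
  have h0 := G.h_nonneg
  have h14 := G.h_le
  have hK₀ := G.K₀_nonneg
  have hK₁ := G.K₁_nonneg
  have hδ : 0 ≤ δ := (norm_nonneg _).trans hy
  have hq0 : 0 ≤ q := nonneg_of_mul_nonneg_right (hδ.trans hq) hs
  have hp0 : 0 ≤ p := nonneg_of_mul_nonneg_right ((norm_nonneg _).trans hp) hs
  have hev : ‖F' u (v - xdag)‖ ≤ √a * (2 * q + 4 * h * p + γ * κ / 2 + S) := by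
    have : F' u (v - xdag) = (yδ - F u - F' u (xdag - u)) - (yδ - F u - F' u (v - u)) := by
      simp only [map_sub]; abel
    rw [this]
    refine (norm_sub_le _ _).trans ?_
    linarith
  constructor
  · have h1 := G.nonlinearity xdag G.xdag_mem u hu (v - xdag)
    have h2 : ‖F' xdag (v - xdag)‖ ≤ ‖F' u (v - xdag)‖ + ‖(F' u - F' xdag) (v - xdag)‖ := by
      rw [sub_apply]
      exact norm_le_norm_add_norm_sub _ _
    have h3 : K₀ * ‖u - xdag‖ ≤ h := by
      refine le_trans ?_ huh
      gcongr; linarith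
    have h4 : K₁ * ‖v - xdag‖ ≤ h := by
      refine le_trans ?_ hvh
      gcongr; linarith
    -- Absorbed into the left side; this produces the leading factor `2`.
    have h5 : K₀ * ‖u - xdag‖ * ‖F' xdag (v - xdag)‖ ≤ 1 / 2 * ‖F' xdag (v - xdag)‖ := by
      gcongr; linarith
    have h6 : K₁ * ‖F' xdag (u - xdag)‖ * ‖v - xdag‖ ≤ h * (√a * p) := by
      calc _ = (K₁ * ‖v - xdag‖) * ‖F' xdag (u - xdag)‖ := by ring
        _ ≤ _ := by gcongr
    linarith
  · have h1 := G.taylor hu ⟨hvb, G.subset hv⟩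
    have h2 : ‖F v - yδ‖ ≤ ‖yδ - F u - F' u (v - u)‖ + ‖F v - F u - F' u (v - u)‖ := by
      have : F v - yδ = (F v - F u - F' u (v - u)) - (yδ - F u - F' u (v - u)) := by abel
      rw [this, add_comm]
      exact norm_sub_le _ _
    have h3 : (K₀ + K₁) * ‖v - u‖ ≤ 2 * h := by
      have : ‖v - u‖ ≤ ‖v - xdag‖ + ‖u - xdag‖ := by
        have : v - u = (v - xdag) - (u - xdag) := by abel
        rw [this]; exact norm_sub_le _ _
      have := mul_le_mul_of_nonneg_left this (add_nonneg hK₀ hK₁)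
      linarith
    have h4 := G.norm_deriv_apply_sub_le hu huh
    have h5 : ‖F' u (v - u)‖ ≤ √a * (2 * q + 4 * h * p + γ * κ / 2 + S) + (1 + h) * (√a * p) := by
      have : F' u (v - u) = F' u (v - xdag) - F' u (u - xdag) := by
        simp only [map_sub]; abel
      rw [this]
      refine (norm_sub_le _ _).trans (add_le_add hev (h4.trans ?_))
      gcongr
    have h6 : (K₀ + K₁) * ‖v - u‖ * ‖F' u (v - u)‖
        ≤ 2 * h * (√a * (2 * q + 4 * h * p + γ * κ / 2 + S) + (1 + h) * (√a * p)) := by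
      gcongr
    have h7 : ‖F v - yδ‖ ≤ √a * ((q + 2 * h * p + γ * κ / 2 + S)
        + 2 * h * ((2 * q + 4 * h * p + γ * κ / 2 + S) + (1 + h) * p)) := by linarith
    refine h7.trans ?_
    gcongr √a * ?_
    have e1 : h * h * p ≤ 1 / 4 * h * p := by gcongr
    have e2 : h * (γ * κ / 2 + S) ≤ 1 / 4 * (γ * κ / 2 + S) := by gcongr
    have e3 : 0 ≤ γ * κ / 2 + S := by positivity
    have e4 : 0 ≤ h * p := by positivity
    nlinarith

theorem mem_of_norm_le (G : GNSetting C D φ F F' xdag ρ γ θ μ K₀ K₁ h α ξ₀ ξdag) {v : X}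
    (hv : v ∈ C) (hd : ‖v - xdag‖ ≤ (2 * γ * μ + 2 * γ ^ 2) * ‖ξ₀ - ξdag‖) :
    v ∈ Metric.ball xdag ρ ∩ D ∧ (K₀ + K₁) * ‖v - xdag‖ ≤ h := by
  refine ⟨⟨?_, G.subset hv⟩, ?_⟩
  · rw [Metric.mem_ball, dist_eq_norm]
    exact hd.trans_lt G.radius_lt
  · refine le_trans ?_ G.small
    have := G.K₀_nonneg
    have := G.K₁_nonneg
    gcongr

theorem initial_bounds (G : GNSetting C D φ F F' xdag ρ γ θ μ K₀ K₁ h α ξ₀ ξdag) {yδ : Y}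
    {x : ℕ → X} (hx : IsRealIterates C φ F F' α ξ₀ yδ x) :
    ‖x 0 - xdag‖ ≤ γ ^ 2 * ‖ξ₀ - ξdag‖ ∧
      ‖F' xdag (x 0 - xdag)‖ ≤ √(α 0) * (γ * ‖ξ₀ - ξdag‖) := by
  have hγ := G.γ_pos
  have h1 := IsSubgradient.norm_sub_le G.uniformConvexOn G.mem (hx.mem 0) G.isSubgradient hx.init
  have h2 : ‖x 0 - xdag‖ ≤ γ ^ 2 * ‖ξ₀ - ξdag‖ := by
    have h3 : γ ^ 2 * (2 * (γ ^ 2)⁻¹ * ‖x 0 - xdag‖) ≤ γ ^ 2 * ‖ξ₀ - ξdag‖ := by gcongr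
    have h4 : γ ^ 2 * (2 * (γ ^ 2)⁻¹ * ‖x 0 - xdag‖) = 2 * ‖x 0 - xdag‖ := by field_simp
    have := norm_nonneg (x 0 - xdag)
    linarith
  refine ⟨h2, ((F' xdag).le_opNorm _).trans ?_⟩
  calc ‖F' xdag‖ * ‖x 0 - xdag‖ ≤ √(α 0) / γ * (γ ^ 2 * ‖ξ₀ - ξdag‖) := by
        gcongr; exact G.scaling
    _ = _ := by field_simp

/-- As long as the noise level is dominated by `μ √(α m) ‖ξ₀ - ξdag‖`, the iterates stay close to
`xdag`. -/
theorem iterates_bounds (G : GNSetting C D φ F F' xdag ρ γ θ μ K₀ K₁ h α ξ₀ ξdag) {yδ : Y} {δ : ℝ}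
    (hy : ‖yδ - F xdag‖ ≤ δ) {x : ℕ → X} (hx : IsRealIterates C φ F F' α ξ₀ yδ x) (n : ℕ)
    (hn : ∀ m < n, δ ≤ √(α m) * (μ * ‖ξ₀ - ξdag‖)) :
    ‖x n - xdag‖ ≤ (2 * γ * μ + 2 * γ ^ 2) * ‖ξ₀ - ξdag‖ ∧
      ‖F' xdag (x n - xdag)‖ ≤ √(α n) * (2 * θ * (4 * μ + γ) * ‖ξ₀ - ξdag‖) := by
  have hγ := G.γ_pos
  have hμ := G.μ_pos
  have hθ := G.one_lt_θ
  have h0 := G.h_nonneg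
  set E := ‖ξ₀ - ξdag‖ with hE
  have hE0 : 0 ≤ E := norm_nonneg _
  induction n with
  | zero =>
    obtain ⟨h1, h2⟩ := G.initial_bounds hx
    constructor
    · refine h1.trans ?_
      gcongr
      nlinarith [mul_pos hγ hμ]
    · refine h2.trans ?_
      gcongr
      nlinarith
  | succ n ih =>
    obtain ⟨ih1, ih2⟩ := ih fun m hm => hn m (hm.trans n.lt_succ_self)
    obtain ⟨hu, huh⟩ := G.mem_of_norm_le (hx.mem n) ih1
    have hsource : (ξ₀ - ξdag) (x (n + 1) - xdag) ≤ E * ‖x (n + 1) - xdag‖ + 0 ^ 2 := by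
      simpa using (le_abs_self _).trans ((ξ₀ - ξdag).le_opNorm (x (n + 1) - xdag))
    have hq := hn n n.lt_succ_self
    obtain ⟨-, -, hd⟩ := G.step_bounds (G.α_pos n) hu huh (hx.mem (n + 1)) hy (hx.step n) hE0 le_rfl
      hsource ih2 hq
    have hd' : ‖x (n + 1) - xdag‖ ≤ (2 * γ * μ + 2 * γ ^ 2) * E := by
      refine hd.trans ?_
      -- The nonlinear contribution costs at most `γ (μ + γ) E`, which doubles `γ μ E + γ² E` and
      -- gives exactly the radius constant.
      have := mul_le_mul_of_nonneg_right G.h_mul_le (mul_nonneg hγ.le hE0)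
      nlinarith
    refine ⟨hd', ?_⟩
    obtain ⟨hv, hvh⟩ := G.mem_of_norm_le (hx.mem (n + 1)) hd'
    obtain ⟨hT, -⟩ := G.step_image_bounds (G.α_pos n) hu huh (hx.mem (n + 1)) hy (hx.step n) hE0
      le_rfl hsource ih2 hq hv.1 hvh
    refine hT.trans ?_
    have hsq := G.sqrt_α_le n
    -- The constant reproduces itself: `2μ + γ/2` comes from noise and source term, and `20 θ h ≤ 1`
    -- bounds the inherited part by `(4μ + γ)/2`.
    have h5 : 20 * θ * h * ((4 * μ + γ) * E) ≤ 1 * ((4 * μ + γ) * E) := by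
      gcongr; exact G.θ_mul_h_le
    calc _ ≤ 2 * (θ * √(α (n + 1))) *
          (2 * (μ * E) + 5 * h * (2 * θ * (4 * μ + γ) * E) + γ * E / 2 + 0) := by gcongr
      _ ≤ 2 * (θ * √(α (n + 1))) * ((4 * μ + γ) * E) := by
        gcongr
        nlinarith
      _ = _ := by ring

end GNSetting

end Step

/-! ### Combinatorics of the stopping rules. -/

namespace StoppingRule

theorem Selects.unique {rule : StoppingRule} {r : ℕ → ℝ} {t : ℝ} {n k : ℕ}
    (hn : rule.Selects r t n) (hk : rule.Selects r t k) : k = n := by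
  cases rule with
  | discrepancy =>
    rcases lt_trichotomy k n with h | h | h
    · exact absurd hk.1 (not_le.2 (hn.2 k h))
    · exact h
    · exact absurd hn.1 (not_le.2 (hk.2 n h))
  | average =>
    rcases hn with ⟨h, rfl⟩ | ⟨h, hn⟩ <;> rcases hk with ⟨h', rfl⟩ | ⟨h', hk⟩
    · rfl
    · exact absurd h (not_le.2 h')
    · exact absurd h' (not_le.2 h)
    · exact hk.unique hn
  | maximum =>
    rcases hn with ⟨h, rfl⟩ | ⟨h, hn⟩ <;> rcases hk with ⟨h', rfl⟩ | ⟨h', hk⟩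
    · rfl
    · exact absurd h (not_le.2 h')
    · exact absurd h' (not_le.2 h)
    · exact hk.unique hn

theorem exists_isLeast_le {s : Set ℕ} {N : ℕ} (hN : N ∈ s) : ∃ n ≤ N, IsLeast s n := by
  classical
  exact ⟨Nat.find ⟨N, hN⟩, Nat.find_min' _ hN, Nat.find_spec ⟨N, hN⟩,
    fun m hm => Nat.find_min' _ hm⟩

theorem exists_selects_le (rule : StoppingRule) {r : ℕ → ℝ} {t : ℝ} {N : ℕ}
    (h : r 0 ≤ t ∨ 2 ≤ N ∧ r N ≤ t ∧ r (N - 1) ≤ t) : ∃ n ≤ N, rule.Selects r t n := by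
  rcases le_or_gt (r 0) t with h0 | h0
  · refine ⟨0, N.zero_le, ?_⟩
    cases rule with
    | discrepancy => exact ⟨h0, fun m hm => absurd hm m.not_lt_zero⟩
    | average => exact Or.inl ⟨h0, rfl⟩
    | maximum => exact Or.inl ⟨h0, rfl⟩
  · obtain ⟨hN, h1, h2⟩ := h.resolve_left (not_le.2 h0)
    cases rule with
    | discrepancy =>
      obtain ⟨n, hn, hl⟩ := exists_isLeast_le (s := {m | r m ≤ t}) h1
      exact ⟨n, hn, hl.1, fun m hm => not_le.1 fun hle => absurd (hl.2 hle) (not_le.2 hm)⟩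
    | average =>
      obtain ⟨n, hn, hl⟩ := exists_isLeast_le
        (s := {m | 1 ≤ m ∧ (1 / 2 : ℝ) * (r m + r (m - 1)) ≤ t}) (N := N)
        ⟨by omega, by linarith⟩
      exact ⟨n, hn, Or.inr ⟨h0, hl⟩⟩
    | maximum =>
      obtain ⟨n, hn, hl⟩ := exists_isLeast_le
        (s := {m | 2 ≤ m ∧ max (r m) (r (m - 1)) ≤ t}) (N := N) ⟨hN, max_le h1 h2⟩
      exact ⟨n, hn, Or.inr ⟨h0, hl⟩⟩

theorem Selects.residual_le {rule : StoppingRule} {r : ℕ → ℝ} {t : ℝ} {n : ℕ}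
    (hn : rule.Selects r t n) (hr : ∀ m, 0 ≤ r m) : r n ≤ 2 * t := by
  have h0 := hr n
  have h1 := hr (n - 1)
  cases rule with
  | discrepancy => have := hn.1; linarith
  | average =>
    rcases hn with ⟨h, rfl⟩ | ⟨-, hn⟩
    · linarith
    · have := hn.1.2; linarith
  | maximum =>
    rcases hn with ⟨h, rfl⟩ | ⟨-, hn⟩
    · linarith
    · have := (le_max_left _ _).trans hn.1.2; linarith

/-- If the residuals at `n - 1` and `n - 2` were both at most `t`, every rule would have stopped by
`n - 1`. The bound `3 ≤ n` makes `n - 1` admissible for the maximum rule and both indices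
successors, as `uniform_decay` requires. -/
theorem Selects.exists_lt_residual {rule : StoppingRule} {r : ℕ → ℝ} {t : ℝ} {n : ℕ}
    (hn : rule.Selects r t n) (h3 : 3 ≤ n) : ∃ j, j + 1 < n ∧ n ≤ j + 3 ∧ t < r (j + 1) := by
  have e1 : n - 2 + 1 = n - 1 := by omega
  have e2 : n - 3 + 1 = n - 2 := by omega
  have e3 : n - 1 - 1 = n - 2 := by omega
  have key : t < r (n - 1) ∨ t < r (n - 2) → ∃ j, j + 1 < n ∧ n ≤ j + 3 ∧ t < r (j + 1) := by
    rintro (h | h)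
    · exact ⟨n - 2, by omega, by omega, e1 ▸ h⟩
    · exact ⟨n - 3, by omega, by omega, e2 ▸ h⟩
  apply key
  by_contra hcon
  push Not at hcon
  obtain ⟨h1, h2⟩ := hcon
  cases rule with
  | discrepancy => exact absurd h1 (not_le.2 (hn.2 _ (by omega)))
  | average =>
    rcases hn with ⟨-, rfl⟩ | ⟨-, hn⟩
    · omega
    · have : n ≤ n - 1 := hn.2 ⟨by omega, by rw [e3]; linarith⟩
      omega
  | maximum =>
    rcases hn with ⟨-, rfl⟩ | ⟨-, hn⟩
    · omega
    · have : n ≤ n - 1 := hn.2 ⟨by omega, by rw [e3]; exact max_le h1 h2⟩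
      omega

end StoppingRule

/-! ### Finite stopping, and decay uniform in the data. -/

theorem eventually_le_of_contraction {P Q : ℕ → ℝ} {b : ℝ} (hb : 0 < b)
    (hP : ∀ n, P (n + 1) = 1 / 2 * P n + Q n) (hQ : ∀ᶠ n in atTop, Q n ≤ b) :
    ∀ᶠ n in atTop, P n ≤ 3 * b := by
  obtain ⟨N, hN⟩ := eventually_atTop.1 hQ
  have h1 : ∀ k, P (k + N) ≤ 2 * b + (1 / 2) ^ k * P N := by
    intro k
    induction k with
    | zero => simp; linarith
    | succ k ih =>
      rw [show k + 1 + N = k + N + 1 by ring, hP, pow_succ]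
      have := hN (k + N) (by omega)
      linarith
  have h2 : Tendsto (fun k : ℕ => 2 * b + (1 / 2 : ℝ) ^ k * P N) atTop (𝓝 (2 * b + 0 * P N)) :=
    ((tendsto_pow_atTop_nhds_zero_of_lt_one (by norm_num) (by norm_num)).mul_const _).const_add _
  have h3 : ∀ᶠ k in atTop, P (k + N) ≤ 3 * b := by
    filter_upwards [h2.eventually_le_const (show 2 * b + 0 * P N < 3 * b by linarith)] with k hk
    exact (h1 k).trans hk
  obtain ⟨M, hM⟩ := eventually_atTop.1 h3
  filter_upwards [eventually_ge_atTop (M + N)] with n hn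
  rw [← Nat.sub_add_cancel (show N ≤ n by omega)]
  exact hM _ (by omega)

namespace GNSetting

variable {X Y : Type*} [NormedAddCommGroup X] [NormedSpace ℝ X]
  [NormedAddCommGroup Y] [NormedSpace ℝ Y]
  {C D : Set X} {φ : X → ℝ} {F : X → Y} {F' : X → X →L[ℝ] Y} {xdag : X}
  {ρ γ θ μ K₀ K₁ h : ℝ} {α : ℕ → ℝ} {ξ₀ ξdag : StrongDual ℝ X}

theorem sqrt_α_pos (G : GNSetting C D φ F F' xdag ρ γ θ μ K₀ K₁ h α ξ₀ ξdag) (n : ℕ) :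
    0 < √(α n) := Real.sqrt_pos.2 (G.α_pos n)

theorem tendsto_sqrt_α (G : GNSetting C D φ F F' xdag ρ γ θ μ K₀ K₁ h α ξ₀ ξdag) :
    Tendsto (fun n => √(α n)) atTop (𝓝 0) := by
  simpa using G.α_tendsto.sqrt

theorem iterates_mem (G : GNSetting C D φ F F' xdag ρ γ θ μ K₀ K₁ h α ξ₀ ξdag) {yδ : Y} {δ : ℝ}
    (hy : ‖yδ - F xdag‖ ≤ δ) {x : ℕ → X} (hx : IsRealIterates C φ F F' α ξ₀ yδ x) (n : ℕ)
    (hn : ∀ m < n, δ ≤ √(α m) * (μ * ‖ξ₀ - ξdag‖)) :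
    x n ∈ Metric.ball xdag ρ ∩ D ∧ (K₀ + K₁) * ‖x n - xdag‖ ≤ h :=
  G.mem_of_norm_le (hx.mem n) (G.iterates_bounds hy hx n hn).1

/-- `N` is the first index with `√(α N) μ E < δ`. One or two steps earlier `√(α n) E` is still at
most `θ δ / μ`, so the source part of the residual is a multiple of `δ`. Two consecutive small
residuals are needed for the average and maximum rules. -/
theorem exists_stopping_bound (G : GNSetting C D φ F F' xdag ρ γ θ μ K₀ K₁ h α ξ₀ ξdag) {τ : ℝ}
    (hμτ : γ * θ / μ < (τ - 1) / 2)
    (hτh : 4 * h + 8 * h * (2 * θ * (4 * μ + γ)) * (θ / μ) ≤ (τ - 1) / 2) {yδ : Y} {δ : ℝ}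
    (hδ : 0 < δ) (hy : ‖yδ - F xdag‖ ≤ δ) {x : ℕ → X}
    (hx : IsRealIterates C φ F F' α ξ₀ yδ x) :
    ∃ N, (∀ m < N, δ ≤ √(α m) * (μ * ‖ξ₀ - ξdag‖)) ∧
      (‖F (x 0) - yδ‖ ≤ τ * δ ∨
        2 ≤ N ∧ ‖F (x N) - yδ‖ ≤ τ * δ ∧ ‖F (x (N - 1)) - yδ‖ ≤ τ * δ) := by
  classical
  have hγ := G.γ_pos
  have hμ := G.μ_pos
  have hθ := G.one_lt_θ
  have h0 := G.h_nonneg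
  have h14 := G.h_le
  set E := ‖ξ₀ - ξdag‖ with hE
  have hE0 : 0 ≤ E := norm_nonneg _
  have hex : ∃ n, √(α n) * (μ * E) < δ := by
    have := G.tendsto_sqrt_α.mul_const (μ * E)
    rw [zero_mul] at this
    exact (this.eventually_lt_const hδ).exists
  have hspec := Nat.find_spec hex
  have hlt : ∀ m < Nat.find hex, δ ≤ √(α m) * (μ * E) :=
    fun m hm => not_lt.1 (Nat.find_min hex hm)
  set N := Nat.find hex with hN
  refine ⟨N, hlt, ?_⟩
  have hα₁ : ∀ n, √(α (n + 1)) ≤ √(α n) := fun n => Real.sqrt_le_sqrt (G.α_anti n)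
  have hres : ∀ n, n + 1 ≤ N → N ≤ n + 2 → ‖F (x (n + 1)) - yδ‖ ≤ τ * δ := by
    intro n hn1 hn2
    obtain ⟨hd, hT⟩ := G.iterates_bounds hy hx n fun m hm => hlt m (by omega)
    obtain ⟨hu, huh⟩ := G.iterates_mem hy hx n fun m hm => hlt m (by omega)
    obtain ⟨hv, hvh⟩ := G.iterates_mem hy hx (n + 1) fun m hm => hlt m (by omega)
    have hs := G.sqrt_α_pos n
    have hsource : (ξ₀ - ξdag) (x (n + 1) - xdag) ≤ E * ‖x (n + 1) - xdag‖ + 0 ^ 2 := by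
      simpa using (le_abs_self _).trans ((ξ₀ - ξdag).le_opNorm (x (n + 1) - xdag))
    -- The exact ratio is used in place of the bound `μ E`, so that the noise enters the residual
    -- with coefficient close to `1`.
    have hq : √(α n) * (δ / √(α n)) = δ := by field_simp
    obtain ⟨-, hr⟩ := G.step_image_bounds (G.α_pos n) hu huh (hx.mem (n + 1)) hy (hx.step n) hE0
      le_rfl hsource hT hq.ge hv.1 hvh
    have hαN : √(α n) * (μ * E) ≤ θ * δ := by
      have hle : √(α n) ≤ θ * √(α N) := by
        obtain hN' | hN' : N = n + 1 ∨ N = n + 2 := by omega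
        · rw [hN']; exact G.sqrt_α_le n
        · rw [hN']; exact G.sqrt_α_le_two n
      calc √(α n) * (μ * E) ≤ θ * √(α N) * (μ * E) := by gcongr
        _ = θ * (√(α N) * (μ * E)) := by ring
        _ ≤ θ * δ := by gcongr
    have hαE : √(α n) * E ≤ θ / μ * δ := by
      rw [div_mul_eq_mul_div, le_div_iff₀ hμ]
      linarith
    have hb : (8 * h * (2 * θ * (4 * μ + γ)) + γ) * (√(α n) * E)
        ≤ (8 * h * (2 * θ * (4 * μ + γ)) + γ) * (θ / μ * δ) := by gcongr
    -- The terms carrying `h` use one half of `τ - 1`, and the hypothesis on `μ` the other.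
    have hc : (4 * h + 8 * h * (2 * θ * (4 * μ + γ)) * (θ / μ) + γ * θ / μ) * δ ≤ (τ - 1) * δ := by
      gcongr
      linarith
    have hd : √(α n) * ((1 + 4 * h) * (δ / √(α n)) + 8 * h * (2 * θ * (4 * μ + γ) * E) + γ * E
        + 2 * 0) = (1 + 4 * h) * (√(α n) * (δ / √(α n)))
          + (8 * h * (2 * θ * (4 * μ + γ)) + γ) * (√(α n) * E) := by ring
    rw [hd, hq] at hr
    have he : (8 * h * (2 * θ * (4 * μ + γ)) + γ) * (θ / μ * δ)
      = (8 * h * (2 * θ * (4 * μ + γ)) * (θ / μ) + γ * θ / μ) * δ := by ring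
    linarith
  rcases Nat.lt_or_ge N 2 with hN2 | hN2
  · left
    have hαN : √(α 0) * (μ * E) ≤ θ * δ := by
      obtain hN' | hN' : N = 0 ∨ N = 1 := by omega
      · rw [hN'] at hspec
        nlinarith
      · rw [hN'] at hspec
        have := G.sqrt_α_le 0
        calc √(α 0) * (μ * E) ≤ θ * √(α (0 + 1)) * (μ * E) := by gcongr
          _ = θ * (√(α 1) * (μ * E)) := by ring
          _ ≤ θ * δ := by gcongr
    have hαE : √(α 0) * E ≤ θ / μ * δ := by
      rw [div_mul_eq_mul_div, le_div_iff₀ hμ]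
      linarith
    obtain ⟨hu, huh⟩ := G.iterates_mem hy hx 0 fun m hm => absurd hm m.not_lt_zero
    have h1 := G.norm_value_sub_le hu huh
    have h2 := (G.initial_bounds hx).2
    have h3 : ‖F (x 0) - yδ‖ ≤ ‖F (x 0) - F xdag‖ + ‖yδ - F xdag‖ := by
      rw [← sub_sub_sub_cancel_right _ _ (F xdag)]
      exact norm_sub_le _ _
    have h4 : (1 + h) * ‖F' xdag (x 0 - xdag)‖ ≤ 2 * (√(α 0) * (γ * E)) := by
      gcongr; linarith
    have h5 : 2 * γ * (√(α 0) * E) ≤ 2 * γ * (θ / μ * δ) := by gcongr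
    have h6 : 2 * (γ * θ / μ) * δ ≤ (τ - 1) * δ := by gcongr; linarith
    have h7 : 2 * γ * (θ / μ * δ) = 2 * (γ * θ / μ) * δ := by ring
    linarith
  · right
    refine ⟨hN2, ?_, ?_⟩
    · have := hres (N - 1) (by omega) (by omega)
      rwa [Nat.sub_add_cancel (by omega)] at this
    · have := hres (N - 2) (by omega) (by omega)
      rwa [show N - 2 + 1 = N - 1 by omega] at this

/-- Majorant of `‖F' xdag (x n - xdag)‖ / √(α n)` for exact data, given an approximate source
element of norm proportional to `W` with defect `κ`. -/
noncomputable def majorant (α : ℕ → ℝ) (γ θ κ W E : ℝ) : ℕ → ℝ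
  | 0 => γ * E
  | n + 1 => 1 / 2 * majorant α γ θ κ W E n + 2 * θ * (γ * κ / 2 + √(W * √(α n)))

/-- The part of `ξ₀ - ξdag` of the form `ω ∘ T` sees only the image error, already known to be
`O(√(α n))`; it vanishes as `n → ∞` and only the defect `κ` remains. -/
theorem source_le (G : GNSetting C D φ F F' xdag ρ γ θ μ K₀ K₁ h α ξ₀ ξdag) {yδ : Y} {δ : ℝ}
    (hy : ‖yδ - F xdag‖ ≤ δ) {x : ℕ → X} (hx : IsRealIterates C φ F F' α ξ₀ yδ x) {κ : ℝ}
    {ω : StrongDual ℝ Y} (hω : ‖ξ₀ - ξdag - ω.comp (F' xdag)‖ ≤ κ) (n : ℕ)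
    (hn : ∀ m < n + 1, δ ≤ √(α m) * (μ * ‖ξ₀ - ξdag‖)) :
    (ξ₀ - ξdag) (x (n + 1) - xdag) ≤ κ * ‖x (n + 1) - xdag‖
      + √(‖ω‖ * (2 * θ * (4 * μ + γ) * ‖ξ₀ - ξdag‖) * √(α n)) ^ 2 := by
  have hγ := G.γ_pos
  have hμ := G.μ_pos
  have hθ := G.one_lt_θ
  have h1 := (G.iterates_bounds hy hx (n + 1) hn).2
  have h2 : √(α (n + 1)) ≤ √(α n) := Real.sqrt_le_sqrt (G.α_anti n)
  rw [Real.sq_sqrt (by positivity)]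
  have h3 : (ξ₀ - ξdag) (x (n + 1) - xdag)
      = (ξ₀ - ξdag - ω.comp (F' xdag)) (x (n + 1) - xdag) + ω (F' xdag (x (n + 1) - xdag)) := by
    simp only [sub_apply, ContinuousLinearMap.comp_apply]; ring
  rw [h3]
  refine add_le_add ?_ ?_
  · refine (Real.le_norm_self _).trans ((ContinuousLinearMap.le_opNorm _ _).trans ?_)
    gcongr
  · refine (Real.le_norm_self _).trans ((ω.le_opNorm _).trans ?_)
    calc ‖ω‖ * ‖F' xdag (x (n + 1) - xdag)‖
        ≤ ‖ω‖ * (√(α n) * (2 * θ * (4 * μ + γ) * ‖ξ₀ - ξdag‖)) := by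
          gcongr
          exact h1.trans (by gcongr)
      _ = _ := by ring

theorem norm_image_le_majorant (G : GNSetting C D φ F F' xdag ρ γ θ μ K₀ K₁ h α ξ₀ ξdag) {yδ : Y}
    {δ : ℝ} (hy : ‖yδ - F xdag‖ ≤ δ) {x : ℕ → X} (hx : IsRealIterates C φ F F' α ξ₀ yδ x) {κ : ℝ}
    {ω : StrongDual ℝ Y} (hω : ‖ξ₀ - ξdag - ω.comp (F' xdag)‖ ≤ κ) (n : ℕ)
    (hn : ∀ m < n, δ ≤ √(α m) * (μ * ‖ξ₀ - ξdag‖)) :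
    ‖F' xdag (x n - xdag)‖ ≤ √(α n) * (majorant α γ θ κ
      (‖ω‖ * (2 * θ * (4 * μ + γ) * ‖ξ₀ - ξdag‖)) ‖ξ₀ - ξdag‖ n + 8 * θ * (δ / √(α n))) := by
  have hγ := G.γ_pos
  have hμ := G.μ_pos
  have hθ := G.one_lt_θ
  have h0 := G.h_nonneg
  have hκ : 0 ≤ κ := (norm_nonneg _).trans hω
  have hδ : 0 ≤ δ := (norm_nonneg _).trans hy
  set W := ‖ω‖ * (2 * θ * (4 * μ + γ) * ‖ξ₀ - ξdag‖) with hW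
  set P := majorant α γ θ κ W ‖ξ₀ - ξdag‖ with hP
  induction n with
  | zero =>
    refine (G.initial_bounds hx).2.trans ?_
    have : P 0 = γ * ‖ξ₀ - ξdag‖ := rfl
    rw [this]
    gcongr
    have : 0 ≤ 8 * θ * (δ / √(α 0)) := by positivity
    linarith
  | succ n ih =>
    have ih := ih fun m hm => hn m (hm.trans n.lt_succ_self)
    obtain ⟨hu, huh⟩ := G.iterates_mem hy hx n fun m hm => hn m (hm.trans n.lt_succ_self)
    obtain ⟨hv, hvh⟩ := G.iterates_mem hy hx (n + 1) hn
    have hs := G.sqrt_α_pos n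
    have hs1 := G.sqrt_α_pos (n + 1)
    have hq : √(α n) * (δ / √(α n)) = δ := by field_simp
    have hmono : δ / √(α n) ≤ δ / √(α (n + 1)) := by
      gcongr; exact G.α_anti n
    obtain ⟨hT, -⟩ := G.step_image_bounds (G.α_pos n) hu huh (hx.mem (n + 1)) hy (hx.step n) hκ
      (Real.sqrt_nonneg _) (G.source_le hy hx hω n hn) ih hq.ge hv.1 hvh
    refine hT.trans ?_
    have hsum : 0 ≤ P n + 8 * θ * (δ / √(α n)) :=
      nonneg_of_mul_nonneg_right ((norm_nonneg _).trans ih) hs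
    have hPs : P (n + 1) = 1 / 2 * P n + 2 * θ * (γ * κ / 2 + √(W * √(α n))) := rfl
    -- The noise coefficient `8θ` is the fixed point of `c ↦ 4θ + c/2`.
    have h5 : 20 * θ * h * (P n + 8 * θ * (δ / √(α n))) ≤ 1 * (P n + 8 * θ * (δ / √(α n))) := by
      gcongr; exact G.θ_mul_h_le
    have h6 : θ * (δ / √(α n)) ≤ θ * (δ / √(α (n + 1))) := by gcongr
    calc _ ≤ 2 * (θ * √(α (n + 1))) * (2 * (δ / √(α n)) + 5 * h * (P n + 8 * θ * (δ / √(α n)))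
          + γ * κ / 2 + √(W * √(α n))) := by
          gcongr; exact G.sqrt_α_le n
      _ = √(α (n + 1)) * (4 * θ * (δ / √(α n)) + 1 / 2 * (20 * θ * h *
          (P n + 8 * θ * (δ / √(α n)))) + 2 * θ * (γ * κ / 2 + √(W * √(α n)))) := by ring
      _ ≤ _ := by
          rw [hPs]
          gcongr √(α (n + 1)) * ?_
          linarith

/-- The majorant involves neither `δ` nor the data, so one `N` serves all of them. It is eventually
`O(κ)`, and `κ` is chosen proportional to `η`. -/
theorem uniform_decay (G : GNSetting C D φ F F' xdag ρ γ θ μ K₀ K₁ h α ξ₀ ξdag)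
    (hsrc : ∀ κ : ℝ, 0 < κ → ∃ ω : StrongDual ℝ Y, ‖ξ₀ - ξdag - ω.comp (F' xdag)‖ ≤ κ) {τ : ℝ}
    (hτh : 4 * h + 64 * θ * h ≤ (τ - 1) / 2) {η : ℝ} (hη : 0 < η) :
    ∃ N, ∀ n ≥ N, ∀ (yδ : Y) (δ : ℝ) (x : ℕ → X), ‖yδ - F xdag‖ ≤ δ →
      IsRealIterates C φ F F' α ξ₀ yδ x →
      (∀ m < n + 1, δ ≤ √(α m) * (μ * ‖ξ₀ - ξdag‖)) →
      ‖x (n + 1) - xdag‖ ≤ 2 * γ * (δ / √(α n)) + η ∧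
        ‖F (x (n + 1)) - yδ‖ ≤ (1 + (τ - 1) / 2) * δ + √(α n) * η := by
  have hγ := G.γ_pos
  have hμ := G.μ_pos
  have hθ := G.one_lt_θ
  have h0 := G.h_nonneg
  have h14 := G.h_le
  -- The first two terms collect the coefficients of `κ` in the error bound, the last two those in
  -- the residual bound.
  set M := 6 * θ * γ ^ 2 + 2 * γ ^ 2 + 12 * θ * γ + 3 * γ with hM
  have hMpos : 0 < M := by positivity
  set κ := η / M with hκdef
  have hκ : 0 < κ := div_pos hη hMpos
  have hκM : κ * M = η := div_mul_cancel₀ _ hMpos.ne'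
  obtain ⟨ω, hω⟩ := hsrc κ hκ
  set W := ‖ω‖ * (2 * θ * (4 * μ + γ) * ‖ξ₀ - ξdag‖) with hW
  set P := majorant α γ θ κ W ‖ξ₀ - ξdag‖ with hP
  have hS : ∀ᶠ n in atTop, √(W * √(α n)) ≤ γ * κ / 2 := by
    have h1 : Tendsto (fun n => √(W * √(α n))) atTop (𝓝 0) := by
      simpa using (G.tendsto_sqrt_α.const_mul W).sqrt
    exact h1.eventually_le_const (by positivity)
  have hPle : ∀ᶠ n in atTop, P n ≤ 3 * (2 * θ * γ * κ) := by
    refine eventually_le_of_contraction (Q := fun n => 2 * θ * (γ * κ / 2 + √(W * √(α n))))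
      (by positivity) (fun n => rfl) ?_
    filter_upwards [hS] with n hn
    have : 2 * θ * (γ * κ / 2 + √(W * √(α n))) ≤ 2 * θ * (γ * κ / 2 + γ * κ / 2) := by gcongr
    linarith
  obtain ⟨N, hN⟩ := eventually_atTop.1 (hS.and hPle)
  refine ⟨N, fun n hn yδ δ x hy hx hδn => ?_⟩
  obtain ⟨hSn, hPn⟩ := hN n hn
  have hδ : 0 ≤ δ := (norm_nonneg _).trans hy
  obtain ⟨hu, huh⟩ := G.iterates_mem hy hx n fun m hm => hδn m (hm.trans n.lt_succ_self)
  obtain ⟨hv, hvh⟩ := G.iterates_mem hy hx (n + 1) hδn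
  have hT := G.norm_image_le_majorant hy hx hω n fun m hm => hδn m (hm.trans n.lt_succ_self)
  have hs := G.sqrt_α_pos n
  have hq : √(α n) * (δ / √(α n)) = δ := by field_simp
  have hsource := G.source_le hy hx hω n hδn
  obtain ⟨-, -, hd⟩ := G.step_bounds (G.α_pos n) hu huh (hx.mem (n + 1)) hy (hx.step n) hκ.le
    (Real.sqrt_nonneg _) hsource hT hq.ge
  obtain ⟨-, hr⟩ := G.step_image_bounds (G.α_pos n) hu huh (hx.mem (n + 1)) hy (hx.step n) hκ.le
    (Real.sqrt_nonneg _) hsource hT hq.ge hv.1 hvh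
  set q := δ / √(α n) with hqdef
  have hq0 : 0 ≤ q := by positivity
  have hhP : h * P n ≤ 1 / 4 * (6 * θ * γ * κ) := by
    calc h * P n ≤ h * (6 * θ * γ * κ) := by gcongr; linarith
      _ ≤ _ := by gcongr
  have hhq : 20 * θ * h * q ≤ 1 * q := by gcongr; exact G.θ_mul_h_le
  rw [← hκM]
  constructor
  · refine hd.trans ?_
    have e1 : γ * (q + 2 * h * (P n + 8 * θ * q)) ≤ γ * (2 * q + 6 * θ * γ * κ) := by
      gcongr γ * ?_
      have : 0 ≤ 6 * θ * γ * κ := by positivity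
      nlinarith
    have e2 : γ * √(W * √(α n)) ≤ γ * (γ * κ) := by
      gcongr
      have : 0 ≤ γ * κ := by positivity
      linarith
    have e3 : 0 ≤ κ * (12 * θ * γ + 3 * γ) := by positivity
    rw [hM]
    linarith
  · refine hr.trans ?_
    have e1 : √(α n) * ((1 + 4 * h) * q + 8 * h * (P n + 8 * θ * q) + γ * κ + 2 * √(W * √(α n)))
        ≤ √(α n) * ((1 + (τ - 1) / 2) * q + κ * M) := by
      gcongr √(α n) * ?_
      have e2 : (4 * h + 64 * θ * h) * q ≤ (τ - 1) / 2 * q := by gcongr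
      have e3 : 0 ≤ κ * (6 * θ * γ ^ 2 + 2 * γ ^ 2 + γ) := by positivity
      rw [hM]
      linarith
    refine e1.trans (le_of_eq ?_)
    rw [← hq]
    ring

end GNSetting

/-! ### Continuous dependence on the data, and convergence. -/

section Stability

variable {X Y : Type*} [NormedAddCommGroup X] [NormedSpace ℝ X]
  [NormedAddCommGroup Y] [InnerProductSpace ℝ Y]

/-- Stability of the minimizer of a regularized least squares functional with respect to the
data `b`, the operator `A` and the linearization point `u`. -/
theorem step_stability {C : Set X} {φ : X → ℝ} {c : ℝ}
    (hφ : UniformConvexOn C (fun r => c * r ^ 2) φ) {b₁ b₂ : Y} {A₁ A₂ : X →L[ℝ] Y}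
    {u₁ u₂ v₁ v₂ : X} {a : ℝ} (ha : 0 < a) {ξ₀ : StrongDual ℝ X} (hv₁ : v₁ ∈ C) (hv₂ : v₂ ∈ C)
    (h₁ : ∀ z ∈ C, ‖b₁ - A₁ (v₁ - u₁)‖ ^ 2 + a * (φ v₁ - ξ₀ v₁)
      ≤ ‖b₁ - A₁ (z - u₁)‖ ^ 2 + a * (φ z - ξ₀ z))
    (h₂ : ∀ z ∈ C, ‖b₂ - A₂ (v₂ - u₂)‖ ^ 2 + a * (φ v₂ - ξ₀ v₂)
      ≤ ‖b₂ - A₂ (z - u₂)‖ ^ 2 + a * (φ z - ξ₀ z))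
    (hA : (‖A₁‖ + ‖A₂‖) * ‖A₁ - A₂‖ ≤ a * c) :
    a * c * ‖v₁ - v₂‖ ≤ 2 * (‖A₁ - A₂‖ * ‖b₁ - A₁ (v₂ - u₁)‖
      + ‖A₂‖ * ‖(b₁ - A₁ (v₂ - u₁)) - (b₂ - A₂ (v₂ - u₂))‖) := by
  have g₁ := step_growth hφ ha hv₁ h₁ hv₂
  have g₂ := step_growth hφ ha hv₂ h₂ hv₁
  rw [norm_sub_rev v₂ v₁] at g₁
  set w := v₁ - v₂ with hw
  set β₁ := b₁ - A₁ (v₂ - u₁) with hβ₁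
  set β₂ := b₂ - A₂ (v₂ - u₂) with hβ₂
  have e₁ : b₁ - A₁ (v₁ - u₁) = β₁ - A₁ w := by
    simp only [hβ₁, hw, map_sub]; abel
  have e₂ : b₂ - A₂ (v₁ - u₂) = β₂ - A₂ w := by
    simp only [hβ₂, hw, map_sub]; abel
  rw [e₁, norm_sub_sq_real β₁ (A₁ w)] at g₁
  rw [e₂, norm_sub_sq_real β₂ (A₂ w)] at g₂
  have i₁ : inner ℝ β₁ (A₁ w) - inner ℝ β₂ (A₂ w)
      = inner ℝ β₁ ((A₁ - A₂) w) + inner ℝ (β₁ - β₂) (A₂ w) := by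
    rw [sub_apply, inner_sub_right β₁, inner_sub_left β₁ β₂]; ring
  have i₂ : inner ℝ β₁ ((A₁ - A₂) w) ≤ ‖β₁‖ * (‖A₁ - A₂‖ * ‖w‖) :=
    (real_inner_le_norm _ _).trans (by gcongr; exact (A₁ - A₂).le_opNorm w)
  have i₃ : inner ℝ (β₁ - β₂) (A₂ w) ≤ ‖β₁ - β₂‖ * (‖A₂‖ * ‖w‖) :=
    (real_inner_le_norm _ _).trans (by gcongr; exact A₂.le_opNorm w)
  -- Adding the two growth inequalities leaves `2 a c ‖w‖²` on the left; by `hA` this difference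
  -- absorbs at most half of it.
  have i₄ : ‖A₂ w‖ ^ 2 - ‖A₁ w‖ ^ 2 ≤ a * c * ‖w‖ ^ 2 := by
    have j₁ : ‖A₂ w‖ - ‖A₁ w‖ ≤ ‖A₁ - A₂‖ * ‖w‖ := by
      refine le_trans ?_ ((A₁ - A₂).le_opNorm w)
      rw [sub_apply, norm_sub_rev]
      exact norm_sub_norm_le _ _
    have j₂ : ‖A₂ w‖ + ‖A₁ w‖ ≤ (‖A₁‖ + ‖A₂‖) * ‖w‖ := by
      have := A₁.le_opNorm w
      have := A₂.le_opNorm w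
      linarith
    calc ‖A₂ w‖ ^ 2 - ‖A₁ w‖ ^ 2 = (‖A₂ w‖ + ‖A₁ w‖) * (‖A₂ w‖ - ‖A₁ w‖) := by ring
      _ ≤ (‖A₂ w‖ + ‖A₁ w‖) * (‖A₁ - A₂‖ * ‖w‖) := by gcongr
      _ ≤ ((‖A₁‖ + ‖A₂‖) * ‖w‖) * (‖A₁ - A₂‖ * ‖w‖) := by gcongr
      _ = (‖A₁‖ + ‖A₂‖) * ‖A₁ - A₂‖ * ‖w‖ ^ 2 := by ring
      _ ≤ _ := by gcongr
  rcases (norm_nonneg w).eq_or_lt with h0 | h0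
  · rw [← h0, mul_zero]; positivity
  · refine le_of_mul_le_mul_right ?_ h0
    nlinarith

namespace GNSetting

variable {C D : Set X} {φ : X → ℝ} {F : X → Y} {F' : X → X →L[ℝ] Y} {xdag : X}
  {ρ γ θ μ K₀ K₁ h : ℝ} {α : ℕ → ℝ} {ξ₀ ξdag : StrongDual ℝ X}

theorem continuousWithinAt (G : GNSetting C D φ F F' xdag ρ γ θ μ K₀ K₁ h α ξ₀ ξdag) {x : X}
    (hx : x ∈ Metric.ball xdag ρ ∩ D) : ContinuousWithinAt F (Metric.ball xdag ρ ∩ D) x := by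
  rw [ContinuousWithinAt, tendsto_iff_norm_sub_tendsto_zero]
  have hc : Continuous fun z : X => (1 + (K₀ + K₁) * ‖z - x‖) * ‖F' x (z - x)‖ := by fun_prop
  have hlim := (hc.tendsto x).mono_left (nhdsWithin_le_nhds (s := Metric.ball xdag ρ ∩ D))
  simp only [sub_self, norm_zero, map_zero, mul_zero] at hlim
  refine squeeze_zero' (Eventually.of_forall fun _ => norm_nonneg _) ?_ hlim
  filter_upwards [self_mem_nhdsWithin] with z hz
  have h1 := G.taylor hx hz
  have h2 : ‖F z - F x‖ ≤ ‖F' x (z - x)‖ + ‖F z - F x - F' x (z - x)‖ :=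
    norm_le_norm_add_norm_sub' _ _
  linarith

theorem continuousWithinAt_deriv (G : GNSetting C D φ F F' xdag ρ γ θ μ K₀ K₁ h α ξ₀ ξdag) {x : X}
    (hx : x ∈ Metric.ball xdag ρ ∩ D) : ContinuousWithinAt F' (Metric.ball xdag ρ ∩ D) x := by
  rw [ContinuousWithinAt, tendsto_iff_norm_sub_tendsto_zero]
  have hc : Continuous fun z : X => (K₀ + K₁) * ‖F' x‖ * ‖z - x‖ := by fun_prop
  have hlim := (hc.tendsto x).mono_left (nhdsWithin_le_nhds (s := Metric.ball xdag ρ ∩ D))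
  simp only [sub_self, norm_zero, mul_zero] at hlim
  refine squeeze_zero' (Eventually.of_forall fun _ => norm_nonneg _) ?_ hlim
  have hK₀ := G.K₀_nonneg
  have hK₁ := G.K₁_nonneg
  filter_upwards [self_mem_nhdsWithin] with z hz
  refine ContinuousLinearMap.opNorm_le_bound _ (by positivity) fun w => ?_
  refine (G.nonlinearity x hx z hz w).trans ?_
  calc K₀ * ‖z - x‖ * ‖F' x w‖ + K₁ * ‖F' x (z - x)‖ * ‖w‖
      ≤ K₀ * ‖z - x‖ * (‖F' x‖ * ‖w‖) + K₁ * (‖F' x‖ * ‖z - x‖) * ‖w‖ := by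
        gcongr
        · exact (F' x).le_opNorm w
        · exact (F' x).le_opNorm _
    _ = _ := by ring

/-- Each iterate depends continuously on the data at the exact data. -/
theorem tendsto_iterates (G : GNSetting C D φ F F' xdag ρ γ θ μ K₀ K₁ h α ξ₀ ξdag) {ι : Type*}
    {l : Filter ι} {Yd : ι → Y} (hY : Tendsto Yd l (𝓝 (F xdag))) {x : ι → ℕ → X}
    (hx : ∀ i, IsRealIterates C φ F F' α ξ₀ (Yd i) (x i)) {z : ℕ → X}
    (hz : IsRealIterates C φ F F' α ξ₀ (F xdag) z) (n : ℕ) :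
    Tendsto (fun i => x i n) l (𝓝 (z n)) ∧ z n ∈ Metric.ball xdag ρ ∩ D ∧
      Tendsto (fun i => F (x i n)) l (𝓝 (F (z n))) := by
  have hγ := G.γ_pos
  have hμ := G.μ_pos
  have hc : 0 < (γ ^ 2)⁻¹ := by positivity
  have hmem : ∀ n, z n ∈ Metric.ball xdag ρ ∩ D := fun n =>
    -- For exact data the noise condition holds at every index, so all noise-free iterates lie in
    -- the ball.
    (G.iterates_mem (δ := 0) (by simp) hz n fun m _ => by positivity).1
  have hwithin : ∀ n, Tendsto (fun i => x i n) l (𝓝 (z n)) →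
      Tendsto (fun i => x i n) l (𝓝[Metric.ball xdag ρ ∩ D] (z n)) := by
    intro n hn
    refine tendsto_nhdsWithin_iff.2 ⟨hn, ?_⟩
    filter_upwards [hn.eventually (Metric.isOpen_ball.mem_nhds (hmem n).1)] with i hi
    exact ⟨hi, G.subset ((hx i).mem n)⟩
  have key : ∀ n, Tendsto (fun i => x i n) l (𝓝 (z n)) := by
    intro n
    induction n with
    | zero =>
      have heq : ∀ i, x i 0 = z 0 := by
        intro i
        have h1 := IsSubgradient.norm_sub_le G.uniformConvexOn (hz.mem 0) ((hx i).mem 0) hz.init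
          (hx i).init
        rw [sub_self, norm_zero] at h1
        have h2 : ‖x i 0 - z 0‖ ≤ 0 := by
          by_contra hpos
          have := mul_pos (mul_pos two_pos hc) (not_le.1 hpos)
          linarith
        exact sub_eq_zero.1 (norm_le_zero_iff.1 h2)
      simp only [heq]
      exact tendsto_const_nhds
    | succ n ih =>
      have hF : Tendsto (fun i => F (x i n)) l (𝓝 (F (z n))) :=
        (G.continuousWithinAt (hmem n)).tendsto.comp (hwithin n ih)
      have hF' : Tendsto (fun i => F' (x i n)) l (𝓝 (F' (z n))) :=
        (G.continuousWithinAt_deriv (hmem n)).tendsto.comp (hwithin n ih)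
      have hb := hY.sub hF
      have happ : Continuous fun p : (X →L[ℝ] Y) × X => p.1 p.2 :=
        continuous_fst.clm_apply continuous_snd
      have hβ : Tendsto (fun i => Yd i - F (x i n) - F' (x i n) (z (n + 1) - x i n)) l
          (𝓝 (F xdag - F (z n) - F' (z n) (z (n + 1) - z n))) :=
        hb.sub ((happ.tendsto _).comp (hF'.prodMk_nhds (tendsto_const_nhds.sub ih)))
      have hdA : Tendsto (fun i => ‖F' (x i n) - F' (z n)‖) l (𝓝 0) :=
        tendsto_iff_norm_sub_tendsto_zero.1 hF'
      have hdβ := tendsto_iff_norm_sub_tendsto_zero.1 hβ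
      have hsmall : ∀ᶠ i in l, (‖F' (x i n)‖ + ‖F' (z n)‖) * ‖F' (x i n) - F' (z n)‖
          ≤ α n * (γ ^ 2)⁻¹ := by
        have := (hF'.norm.add_const ‖F' (z n)‖).mul hdA
        rw [mul_zero] at this
        exact this.eventually_le_const (mul_pos (G.α_pos n) hc)
      have hbound := ((hdA.mul hβ.norm).add (hdβ.const_mul ‖F' (z n)‖)).const_mul
        (2 * (α n * (γ ^ 2)⁻¹)⁻¹)
      rw [zero_mul, mul_zero, add_zero, mul_zero] at hbound
      rw [tendsto_iff_norm_sub_tendsto_zero]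
      refine squeeze_zero' (Eventually.of_forall fun _ => norm_nonneg _) ?_ hbound
      filter_upwards [hsmall] with i hi
      have h1 := step_stability G.uniformConvexOn (G.α_pos n) ((hx i).mem (n + 1))
        (hz.mem (n + 1)) ((hx i).step n) (hz.step n) hi
      have hpos : 0 < α n * (γ ^ 2)⁻¹ := mul_pos (G.α_pos n) hc
      rw [mul_comm 2, mul_assoc, le_inv_mul_iff₀ hpos]
      exact h1
  exact ⟨key n, hmem n, (G.continuousWithinAt (hmem n)).tendsto.comp (hwithin n (key n))⟩

theorem selects_le (G : GNSetting C D φ F F' xdag ρ γ θ μ K₀ K₁ h α ξ₀ ξdag) {τ : ℝ}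
    (hμτ : γ * θ / μ < (τ - 1) / 2)
    (hτh : 4 * h + 8 * h * (2 * θ * (4 * μ + γ)) * (θ / μ) ≤ (τ - 1) / 2) (rule : StoppingRule)
    {yδ : Y} {δ : ℝ} (hδ : 0 < δ) (hy : ‖yδ - F xdag‖ ≤ δ) {x : ℕ → X}
    (hx : IsRealIterates C φ F F' α ξ₀ yδ x) :
    ∃ n, rule.Selects (fun m => ‖F (x m) - yδ‖) (τ * δ) n ∧
      ∀ m < n, δ ≤ √(α m) * (μ * ‖ξ₀ - ξdag‖) := by
  obtain ⟨N, hN, hres⟩ := G.exists_stopping_bound hμτ hτh hδ hy hx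
  obtain ⟨n, hn, hsel⟩ := rule.exists_selects_le
    (r := fun m => ‖F (x m) - yδ‖) (t := τ * δ) (N := N) hres
  exact ⟨n, hsel, fun m hm => hN m (by omega)⟩

theorem convergence (G : GNSetting C D φ F F' xdag ρ γ θ μ K₀ K₁ h α ξ₀ ξdag) {τ : ℝ} (hτ : 1 < τ)
    (hμτ : γ * θ / μ < (τ - 1) / 2)
    (hτh : 4 * h + 8 * h * (2 * θ * (4 * μ + γ)) * (θ / μ) ≤ (τ - 1) / 2)
    (hτh' : 4 * h + 64 * θ * h ≤ (τ - 1) / 2)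
    (hsrc : ∀ κ : ℝ, 0 < κ → ∃ ω : StrongDual ℝ Y, ‖ξ₀ - ξdag - ω.comp (F' xdag)‖ ≤ κ)
    (huniq : ∀ x ∈ Metric.ball xdag ρ ∩ D, F x = F xdag → x = xdag)
    (hex : ∀ yδ : Y, ∃ x : ℕ → X, IsRealIterates C φ F F' α ξ₀ yδ x) (rule : StoppingRule)
    {η : ℝ} (hη : 0 < η) :
    ∃ δ₀ : ℝ, 0 < δ₀ ∧ ∀ δ : ℝ, 0 < δ → δ < δ₀ → ∀ yδ : Y, ‖yδ - F xdag‖ ≤ δ →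
      ∀ (x : ℕ → X) (n : ℕ), IsRealIterates C φ F F' α ξ₀ yδ x →
        rule.Selects (fun m => ‖F (x m) - yδ‖) (τ * δ) n → ‖x n - xdag‖ < η := by
  have hγ := G.γ_pos
  have hθ := G.one_lt_θ
  have hτ1 : 0 < τ - 1 := sub_pos.2 hτ
  -- At a late stopping index `δ / √(α n)` will turn out to be at most `θ · 2η'/(τ - 1)`; the left
  -- side is the resulting error bound.
  obtain ⟨η', hη', hη'lt⟩ : ∃ η' : ℝ, 0 < η' ∧ 2 * γ * (θ * (2 * η' / (τ - 1))) + η' < η := by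
    refine ⟨η / (2 * (1 + 4 * γ * θ / (τ - 1))), by positivity, ?_⟩
    have hpos : 0 < 1 + 4 * γ * θ / (τ - 1) := by positivity
    generalize hQ : η / (2 * (1 + 4 * γ * θ / (τ - 1))) = Q
    have : Q * (1 + 4 * γ * θ / (τ - 1)) = η / 2 := by
      rw [← hQ]; field_simp
    have e : 2 * γ * (θ * (2 * Q / (τ - 1))) + Q = Q * (1 + 4 * γ * θ / (τ - 1)) := by ring
    rw [e, this]
    linarith
  obtain ⟨N, hN⟩ := G.uniform_decay hsrc hτh' hη'
  obtain ⟨z, hz⟩ := hex (F xdag)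
  -- Indexing by data together with their iterates, filtered by convergence of the data, makes the
  -- limits uniform over all `yδ` within distance `δ`.
  let ι := {p : Y × (ℕ → X) // IsRealIterates C φ F F' α ξ₀ p.1 p.2}
  let l : Filter ι := comap (fun p : ι => p.1.1) (𝓝 (F xdag))
  have hY : Tendsto (fun p : ι => p.1.1) l (𝓝 (F xdag)) := tendsto_comap
  have hfew : ∀ n, ∃ d : ℝ, 0 < d ∧ ∀ δ : ℝ, 0 < δ → δ < d → ∀ yδ : Y, ‖yδ - F xdag‖ ≤ δ →
      ∀ x : ℕ → X, IsRealIterates C φ F F' α ξ₀ yδ x →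
        ‖F (x n) - yδ‖ ≤ 2 * (τ * δ) → ‖x n - xdag‖ < η := by
    intro n
    obtain ⟨h1, h2, h3⟩ := G.tendsto_iterates hY (fun p => p.2) hz n
    have hev : ∃ d : ℝ, 0 < d ∧ ∀ p : ι, ‖p.1.1 - F xdag‖ < d →
        (2 * (τ * d) < ‖F (p.1.2 n) - p.1.1‖ ∨ ‖p.1.2 n - xdag‖ < η) := by
      by_cases hcase : F (z n) = F xdag
      · have hzn := huniq _ h2 hcase
        rw [hzn] at h1
        have hev := h1.eventually (Metric.ball_mem_nhds xdag hη)
        obtain ⟨t, ht, hts⟩ := (mem_comap.1 hev)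
        obtain ⟨d, hd, hball⟩ := Metric.mem_nhds_iff.1 ht
        refine ⟨d, hd, fun p hp => Or.inr ?_⟩
        have : p ∈ (fun p : ι => p.1.1) ⁻¹' t := hball (by
          rwa [Metric.mem_ball, dist_eq_norm])
        have := hts this
        rwa [← dist_eq_norm]
      -- Here residuals near the exact data exceed half of `‖F (z n) - F xdag‖`. The bound `/ (4 *
      -- τ)` keeps `2 τ d` below that half, so a selected index cannot fall in this case.
      · have hpos : 0 < ‖F (z n) - F xdag‖ := norm_pos_iff.2 (sub_ne_zero.2 hcase)
        have hev := ((h3.sub hY).norm).eventually_const_lt (half_lt_self hpos)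
        obtain ⟨t, ht, hts⟩ := (mem_comap.1 hev)
        obtain ⟨d, hd, hball⟩ := Metric.mem_nhds_iff.1 ht
        refine ⟨min d (‖F (z n) - F xdag‖ / (4 * τ)), by positivity, fun p hp => Or.inl ?_⟩
        have : p ∈ (fun p : ι => p.1.1) ⁻¹' t := hball (by
          rw [Metric.mem_ball, dist_eq_norm]
          exact hp.trans_le (min_le_left _ _))
        refine lt_of_le_of_lt ?_ (hts this)
        have hmin := min_le_right d (‖F (z n) - F xdag‖ / (4 * τ))
        rw [le_div_iff₀ (by positivity)] at hmin
        linarith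
    obtain ⟨d, hd, hdp⟩ := hev
    refine ⟨d, hd, fun δ hδ hδd yδ hy x hx hle => ?_⟩
    refine (hdp ⟨(yδ, x), hx⟩ (hy.trans_lt hδd)).resolve_left (not_lt.2 ?_)
    refine hle.trans ?_
    gcongr
  choose d hd hdp using hfew
  obtain ⟨δ₀, hδ₀, hδ₀le⟩ : ∃ δ₀ : ℝ, 0 < δ₀ ∧ ∀ n < N + 3, δ₀ ≤ d n := by
    refine ⟨(Finset.range (N + 3)).inf' (Finset.nonempty_range_iff.2 (by omega)) d, ?_, fun n hn => ?_⟩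
    · rw [Finset.lt_inf'_iff]
      exact fun n _ => hd n
    · exact Finset.inf'_le _ (Finset.mem_range.2 hn)
  refine ⟨δ₀, hδ₀, fun δ hδ hδlt yδ hy x n hx hsel => ?_⟩
  rcases lt_or_ge n (N + 3) with hnN | hnN
  · exact hdp n δ hδ (hδlt.trans_le (hδ₀le n hnN)) yδ hy x hx
      (hsel.residual_le fun m => norm_nonneg _)
  · obtain ⟨n', hsel', hdom⟩ := G.selects_le hμτ hτh rule hδ hy hx
    obtain rfl := hsel'.unique hsel
    obtain ⟨j, hj1, hj2, hj⟩ := hsel.exists_lt_residual (by omega)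
    obtain ⟨k, rfl⟩ : ∃ k, n = k + 1 := ⟨n - 1, by omega⟩
    obtain ⟨-, hr⟩ := hN j (by omega) yδ δ x hy hx fun m hm => hdom m (by omega)
    obtain ⟨hdk, -⟩ := hN k (by omega) yδ δ x hy hx hdom
    refine hdk.trans_lt (lt_of_le_of_lt ?_ hη'lt)
    gcongr
    have hαjk : √(α j) ≤ θ * √(α k) := by
      obtain hk | hk : k = j + 1 ∨ k = j + 2 := by omega
      · rw [hk]; exact G.sqrt_α_le j
      · rw [hk]; exact G.sqrt_α_le_two j
    have hs := G.sqrt_α_pos k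
    rw [div_le_iff₀ hs]
    -- The residual at `j + 1` exceeds `τ δ` but is at most `(1 + (τ - 1)/2) δ + √(α j) η'`.
    have h1 : δ ≤ √(α j) * (2 * η' / (τ - 1)) := by
      rw [mul_div_assoc', le_div_iff₀ hτ1]
      linarith
    calc δ ≤ √(α j) * (2 * η' / (τ - 1)) := h1
      _ ≤ θ * √(α k) * (2 * η' / (τ - 1)) := by gcongr
      _ = _ := by ring

end GNSetting

end Stability

/-! ### Choice of constants and assembly. -/

theorem exists_small_constant {γ θ τ μ : ℝ} (hγ : 0 < γ) (hθ : 1 < θ) (hτ : 1 < τ)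
    (hμ : 0 < μ) :
    ∃ h : ℝ, 0 < h ∧ h ≤ 1 / 4 ∧ 20 * θ * h ≤ 1 ∧ 2 * h * (2 * θ * (4 * μ + γ)) ≤ μ + γ ∧
      4 * h + 8 * h * (2 * θ * (4 * μ + γ)) * (θ / μ) ≤ (τ - 1) / 2 ∧
      4 * h + 64 * θ * h ≤ (τ - 1) / 2 := by
  have hτ1 : 0 < τ - 1 := sub_pos.2 hτ
  -- Every requirement is linear in `h` with a positive right-hand side, so all hold for small
  -- positive `h`.
  have key : ∀ a b : ℝ, 0 < b → ∀ᶠ h : ℝ in 𝓝[>] 0, a * h ≤ b := by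
    intro a b hb
    have h1 : Tendsto (fun h : ℝ => a * h) (𝓝[>] 0) (𝓝 (a * 0)) :=
      (Continuous.tendsto (by fun_prop) 0).mono_left nhdsWithin_le_nhds
    rw [mul_zero] at h1
    exact h1.eventually_le_const hb
  have hev : ∀ᶠ h : ℝ in 𝓝[>] 0, 0 < h := self_mem_nhdsWithin
  obtain ⟨h, h0, h1, h2, h3, h4, h5⟩ := (hev.and ((key 1 (1 / 4) (by norm_num)).and
    ((key (20 * θ) 1 one_pos).and ((key (2 * (2 * θ * (4 * μ + γ))) (μ + γ) (by positivity)).and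
    ((key (4 + 8 * (2 * θ * (4 * μ + γ)) * (θ / μ)) ((τ - 1) / 2) (by positivity)).and
    (key (4 + 64 * θ) ((τ - 1) / 2) (by positivity))))))).exists
  exact ⟨h, h0, by linarith, h2, by linarith, by linarith, by linarith⟩

theorem IsParamSeq.le {θ : ℝ} {α : ℕ → ℝ} (h : IsParamSeq θ α) (n : ℕ) :
    α (n + 1) ≤ α n ∧ α n ≤ θ * α (n + 1) := by
  have h1 := h.one_le_ratio n
  have h2 := h.ratio_le n
  rw [one_le_div (h.pos _)] at h1
  rw [div_le_iff₀ (h.pos _)] at h2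
  exact ⟨h1, h2⟩

/-- Thanks to the square root, going back two steps costs only one factor `θ`; this matches the
condition `γ θ / μ < (τ - 1) / 2`. -/
theorem IsParamSeq.sqrt_le_two {θ : ℝ} (hθ : 1 < θ) {α : ℕ → ℝ} (h : IsParamSeq θ α)
    (n : ℕ) : √(α n) ≤ θ * √(α (n + 2)) := by
  have h1 := (h.le n).2
  have h2 := (h.le (n + 1)).2
  have h3 : α n ≤ θ ^ 2 * α (n + 2) := by
    calc α n ≤ θ * α (n + 1) := h1
      _ ≤ θ * (θ * α (n + 1 + 1)) := by gcongr
      _ = _ := by ring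
  calc √(α n) ≤ √(θ ^ 2 * α (n + 2)) := Real.sqrt_le_sqrt h3
    _ = θ * √(α (n + 2)) := by
      rw [Real.sqrt_mul (sq_nonneg θ), Real.sqrt_sq (by linarith)]

theorem IsParamSeq.sqrt_le {θ : ℝ} (hθ : 1 < θ) {α : ℕ → ℝ} (h : IsParamSeq θ α)
    (n : ℕ) : √(α n) ≤ θ * √(α (n + 1)) := by
  have h1 := (h.le n).2
  have h3 : α n ≤ θ ^ 2 * α (n + 1) := by
    have := h.pos (n + 1)
    refine h1.trans ?_
    gcongr
    nlinarith
  calc √(α n) ≤ √(θ ^ 2 * α (n + 1)) := Real.sqrt_le_sqrt h3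
    _ = θ * √(α (n + 1)) := by
      rw [Real.sqrt_mul (sq_nonneg θ), Real.sqrt_sq (by linarith)]

end IRGN

theorem theorem5p2 (γ θ τ μ : ℝ) (hγ : 0 < γ) (hθ : 1 < θ) (hτ : 1 < τ) (hμ : 0 < μ)
    (hμτ : γ * θ / μ < (τ - 1) / 2) :
    ∃ ε : ℝ, 0 < ε ∧
      ∀ (X : Type*) [NormedAddCommGroup X] [NormedSpace ℝ X] [CompleteSpace X]
        (Y : Type*) [NormedAddCommGroup Y] [InnerProductSpace ℝ Y] [CompleteSpace Y]
        (Θ : X → EReal) (D : Set X) (F : X → Y) (F' : X → X →L[ℝ] Y) (y : Y) (xdag : X)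
        (ρ K₀ K₁ : ℝ) (α : ℕ → ℝ) (ξ₀ ξdag : StrongDual ℝ X),
        IRGN.IsReflexiveSpace X →
        IRGN.IsProper Θ → LowerSemicontinuous Θ → IRGN.IsTwoConvex Θ →
        IRGN.IsBregmanConstant Θ γ →
        IRGN.IsParamSeq θ α →
        IRGN.OperatorConditions Θ D F F' y xdag ρ γ (α 0) K₀ K₁ →
        (∀ x ∈ Metric.ball xdag ρ ∩ D, F x = y → x = xdag) →
        ξdag ∈ IRGN.subdiff (IRGN.restrictTo Θ D) xdag →
        ‖ξ₀ - ξdag‖ = Metric.infDist ξ₀ (IRGN.subdiff (IRGN.restrictTo Θ D) xdag) →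
        ξ₀ - ξdag ∈ IRGN.nullAnnihilator (F' xdag) →
        (2 * γ * μ + 2 * γ ^ 2) * ‖ξ₀ - ξdag‖ < ρ →
        (K₀ + K₁) * ‖ξ₀ - ξdag‖ ≤ ε →
        -- the iterates exist and are unique
        (∀ yδ : Y, ∃! x : ℕ → X, IRGN.IsIterates Θ D F F' α ξ₀ yδ x) ∧
        -- each rule stops at a unique index, up to which the iterates stay in the ball
        (∀ (rule : IRGN.StoppingRule) (δ : ℝ), 0 < δ → ∀ yδ : Y, ‖yδ - y‖ ≤ δ →
          ∀ x : ℕ → X, IRGN.IsIterates Θ D F F' α ξ₀ yδ x →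
            ∃ n, rule.Selects (fun m => ‖F (x m) - yδ‖) (τ * δ) n ∧
              (∀ k, rule.Selects (fun m => ‖F (x m) - yδ‖) (τ * δ) k → k = n) ∧
              ∀ m ≤ n, x m ∈ Metric.ball xdag ρ ∩ D) ∧
        -- the selected iterates converge in norm as the noise level tends to zero
        (∀ (rule : IRGN.StoppingRule) (η : ℝ), 0 < η → ∃ δ₀ : ℝ, 0 < δ₀ ∧
          ∀ δ : ℝ, 0 < δ → δ < δ₀ → ∀ yδ : Y, ‖yδ - y‖ ≤ δ →
            ∀ (x : ℕ → X) (n : ℕ), IRGN.IsIterates Θ D F F' α ξ₀ yδ x →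
              rule.Selects (fun m => ‖F (x m) - yδ‖) (τ * δ) n →
                ‖x n - xdag‖ < η) := by
  obtain ⟨h, h0, h1, h2, h3, h4, h5⟩ := IRGN.exists_small_constant hγ hθ hτ hμ
  have hM : 0 < 2 * γ * μ + 2 * γ ^ 2 := by positivity
  -- The iterates stay within `(2γμ + 2γ²) E` of `xdag`, so this `ε` keeps `(K₀ + K₁) ‖x n - xdag‖ ≤
  -- h` along the iteration.
  refine ⟨h / (2 * γ * μ + 2 * γ ^ 2), div_pos h0 hM, ?_⟩
  intro X _ _ _ Y _ _ _ Θ D F F' y xdag ρ K₀ K₁ α ξ₀ ξdag hrefl hΘ hlsc h2c hB hα hop huniq hξdag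
    _ hann hrad hsmall
  set C := D ∩ IRGN.effDomain Θ with hC
  set φ := fun x => (Θ x).toReal with hφ
  obtain rfl := hop.solution
  have hxC : xdag ∈ C := ⟨hop.mem_domain, hop.mem_subdiffDomain.1⟩
  have huc : UniformConvexOn C (fun r => (γ ^ 2)⁻¹ * r ^ 2) φ :=
    IRGN.uniformConvexOn_restrict hΘ hlsc h2c hB hop.mem_subdiffDomain hop.convex
  have hcl : IRGN.HasClosedEpigraph C φ := IRGN.hasClosedEpigraph_toReal hΘ hlsc hop.isClosed
  have hsub : IRGN.IsSubgradient C φ ξdag xdag := by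
    rw [IRGN.restrictTo_eq_extendTop hΘ] at hξdag
    exact (IRGN.mem_subdiff_extendTop hxC).1 hξdag
  have hc : 0 < (γ ^ 2)⁻¹ := by positivity
  have hiff : ∀ {yδ : Y} {x : ℕ → X}, IRGN.IsIterates Θ D F F' α ξ₀ yδ x ↔
      IRGN.IsRealIterates C φ F F' α ξ₀ yδ x :=
    IRGN.isIterates_iff hΘ hlsc hop.isClosed hc huc hxC hsub hα.pos
  have hexu := IRGN.existsUnique_isRealIterates hc huc hcl hxC hsub F F' hα.pos ξ₀
  have G : IRGN.GNSetting C D φ F F' xdag ρ γ θ μ K₀ K₁ h α ξ₀ ξdag :=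
    { γ_pos := hγ, one_lt_θ := hθ, μ_pos := hμ, h_nonneg := h0.le, h_le := h1, θ_mul_h_le := h2
      h_mul_le := h3, subset := inter_subset_left, convex := hop.convex, mem := hxC
      deriv := hop.deriv, scaling := hop.scaling, K₀_nonneg := hop.K₀_nonneg
      K₁_nonneg := hop.K₁_nonneg, nonlinearity := hop.nonlinearity, α_pos := hα.pos
      α_anti := fun n => (hα.le n).1, sqrt_α_le := hα.sqrt_le hθ
      sqrt_α_le_two := hα.sqrt_le_two hθ, α_tendsto := hα.tendsto_zero, uniformConvexOn := huc
      isSubgradient := hsub, radius_lt := hrad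
      small := by
        rw [le_div_iff₀ hM] at hsmall
        linarith }
  refine ⟨fun yδ => ?_, fun rule δ hδ yδ hy x hx => ?_, fun rule η hη => ?_⟩
  · simpa only [hiff] using hexu yδ
  · obtain ⟨n, hsel, hdom⟩ := G.selects_le hμτ h4 rule hδ hy (hiff.1 hx)
    exact ⟨n, hsel, fun k hk => hsel.unique hk, fun m hm =>
      (G.iterates_mem hy (hiff.1 hx) m fun i hi => hdom i (hi.trans_le hm)).1⟩
  · obtain ⟨δ₀, hδ₀, hconv⟩ := G.convergence hτ hμτ h4 h5
      (fun κ hκ => IRGN.exists_approx_source hrefl (F' xdag) hann hκ) huniq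
      (fun yδ => (hexu yδ).exists) rule hη
    exact ⟨δ₀, hδ₀, fun δ hδ hlt yδ hy x n hx hsel => hconv δ hδ hlt yδ hy x n (hiff.1 hx) hsel⟩
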